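/- **Setting.** Let $k\ge 1$ and let $\mathbf n=(n_1,\dots,n_k)$, $\mathbf m=(m_1,\dots,m_k)$ be tuples of positive integers. For each $i$ let $f_i=\sum_{\alpha\in\mathbb F_{n_i}^+}a_{i,\alpha}Z_\alpha$ be a positive regular free holomorphic function in $n_i$ noncommuting variables: $a_{i,\alpha}\ge 0$, $a_{i,g_0}=0$, $a_{i,g_j}>0$ for $1\le j\le n_i$, and $\limsup_{q\to\infty}\big(\sum_{|\alpha|=q}|a_{i,\alpha}|^2\big)^{1/2q}<\infty$, where $\mathbb F_{n_i}^+$ is the free unital semigroup with generators $g_1,\dots,g_{n_i}$ and identity $g_0$. All Hilbert spaces are complex. For a tuple $X_i=(X_{i,1},\dots,X_{i,n_i})$ in $B(\mathcal H)$ put $\Phi_{f_i,X_i}(Y)=\sum_{|\alpha|\ge1}a_{i,\alpha}X_{i,\alpha}YX_{i,\alpha}^*$ (convergence in the weak operator topology), and for $\mathbf X=(X_1,\dots,X_k)$ and $\mathbf p\in\mathbb Z_+^k$ put $\mathbf\Delta^{\mathbf p}_{\mathbf f,\mathbf X}=(id-\Phi_{f_1,X_1})^{p_1}\cdots(id-\Phi_{f_k,X_k})^{p_k}$.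 The noncommutative polydomain $\mathbf D^{\mathbf m}_{\mathbf f}(\mathcal H)$ is the set of those $\mathbf X$ for which the entries of $X_i$ commute with the entries of $X_{i'}$ whenever $i\neq i'$, each $\Phi_{f_i,X_i}(I)$ exists and is $\le I$, and $\mathbf\Delta^{(\epsilon_1m_1,\dots,\epsilon_km_k)}_{\mathbf f,\mathbf X}(I)\ge0$ for all $\epsilon\in\{0,1\}^k$. Let $b^{(m_i)}_{i,g_0}=1$ and $b^{(m_i)}_{i,\alpha}=\sum_{p=1}^{|\alpha|}\sum_{\gamma_1\cdots\gamma_p=\alpha,\,|\gamma_s|\ge1}a_{i,\gamma_1}\cdots a_{i,\gamma_p}\binom{p+m_i-1}{m_i-1}$ for $|\alpha|\ge1$. Let $F^2(H_{n_i})$ be the full Fock space with orthonormal basis $(e^i_\alpha)_{\alpha\in\mathbb F_{n_i}^+}$, and let $\mathbf F=F^2(H_{n_1})\otimes\cdots\otimes F^2(H_{n_k})$. The universal model $\mathbf W=(\mathbf W_{i,j})$ on $\mathbf F$ consists of the operators acting on the $i$-th factor by $e^i_\alpha\mapsto\sqrt{b^{(m_i)}_{i,\alpha}/b^{(m_i)}_{i,g_j\alpha}}\;e^i_{g_j\alpha}$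 and as the identity on the other factors. A bounded operator $M:\mathbf F\otimes\mathcal E\to\mathbf F\otimes\mathcal G$ is *multi-analytic* if $M(\mathbf W_{i,j}\otimes I_{\mathcal E})=(\mathbf W_{i,j}\otimes I_{\mathcal G})M$ for all $i,j$. For $\mathbf T\in\mathbf D^{\mathbf m}_{\mathbf f}(\mathcal H)$ put $\mathcal D_{\mathbf T}=\overline{\mathbf\Delta^{\mathbf m}_{\mathbf f,\mathbf T}(I)\mathcal H}$. The noncommutative Berezin kernel $\mathbf K_{\mathbf f,\mathbf T}:\mathcal H\to\mathbf F\otimes\mathcal D_{\mathbf T}$ is given by $$\mathbf K_{\mathbf f,\mathbf T}h=\sum_{\beta_i\in\mathbb F_{n_i}^+}\sqrt{b^{(m_1)}_{1,\beta_1}}\cdots\sqrt{b^{(m_k)}_{k,\beta_k}}\;e^1_{\beta_1}\otimes\cdots\otimes e^k_{\beta_k}\otimes\mathbf\Delta^{\mathbf m}_{\mathbf f,\mathbf T}(I)^{1/2}T_{1,\beta_1}^*\cdots T_{k,\beta_k}^*h .$$ We say that $\mathbf T$ *admits a characteristic function* if there are a Hilbert space $\mathcal E$ and a multi-analytic operator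 $\Psi:\mathbf F\otimes\mathcal E\to\mathbf F\otimes\mathcal D_{\mathbf T}$ with $\mathbf K_{\mathbf f,\mathbf T}\mathbf K_{\mathbf f,\mathbf T}^*+\Psi\Psi^*=I$. **Theorem.** Let $\mathcal H$ be a Hilbert space and $\mathbf T\in\mathbf D^{\mathbf m}_{\mathbf f}(\mathcal H)$. Then $\mathbf K_{\mathbf f,\mathbf T}$ is a well-defined bounded operator, and $\mathbf T$ admits a characteristic function if and only if $$\mathbf\Delta^{\mathbf p}_{\mathbf f,\mathbf W\otimes I}\big(I-\mathbf K_{\mathbf f,\mathbf T}\mathbf K_{\mathbf f,\mathbf T}^*\big)\ge0\qquad\text{for every }\mathbf p\in\mathbb Z_+^k\text{ with }\mathbf p\le\mathbf m .$$ Moreover, suppose that $\mathbf T$ admits a characteristic function. Put $Y=I-\mathbf K_{\mathbf f,\mathbf T}\mathbf K_{\mathbf f,\mathbf T}^*$ and $\mathcal M_{\mathbf T}=\overline{\operatorname{range}Y}$. Then there are unique bounded operators $A_{i,j}$ on $\mathcal M_{\mathbf T}$ with $A_{i,j}Y^{1/2}x=Y^{1/2}(\mathbf W_{i,j}^*\otimes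 I)x$ for all $x\in\mathbf F\otimes\mathcal D_{\mathbf T}$; the tuple $\mathbf M_{\mathbf T}=(A_{i,j}^*)$ belongs to $\mathbf D^{\mathbf m}_{\mathbf f}(\mathcal M_{\mathbf T})$, so that its Berezin kernel $\mathbf K_{\mathbf f,\mathbf M_{\mathbf T}}:\mathcal M_{\mathbf T}\to\mathbf F\otimes\mathcal D_{\mathbf M_{\mathbf T}}$ is a well-defined bounded operator; and $$\Theta_{\mathbf f,\mathbf T}:=Y^{1/2}\,\mathbf K_{\mathbf f,\mathbf M_{\mathbf T}}^*:\ \mathbf F\otimes\mathcal D_{\mathbf M_{\mathbf T}}\to\mathbf F\otimes\mathcal D_{\mathbf T}$$ is a multi-analytic operator with $\mathbf K_{\mathbf f,\mathbf T}\mathbf K_{\mathbf f,\mathbf T}^*+\Theta_{\mathbf f,\mathbf T}\Theta_{\mathbf f,\mathbf T}^*=I$. -/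

import Mathlib

open ContinuousLinearMap Filter

namespace NCPolydomain

noncomputable section

universe u

/-! ### Positive regular free holomorphic functions

A word in the free unital semigroup on `n` generators is a list of letters `j : Fin n`; the empty
list is the neutral element, concatenation is the product and `j :: α` is `g_j α`. -/

/-- A positive regular free holomorphic function `f = ∑_α a_α Z_α` in `n` noncommuting variables:
`a_α ≥ 0`, `a_{g_0} = 0`, `a_{g_j} > 0`, and
`limsup_q (∑_{|α| = q} |a_α|²)^{1/(2q)} < ∞`. -/
structure PosRegular (n : ℕ) where
  coeff : List (Fin n) → ℝ
  coeff_nonneg : ∀ α, 0 ≤ coeff α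
  coeff_nil : coeff [] = 0
  coeff_letter_pos : ∀ j, 0 < coeff [j]
  growth : limsup (fun q : ℕ =>
      (((∑ α : Fin q → Fin n, |coeff (List.ofFn α)| ^ 2) ^ (1 / (2 * (q : ℝ))) : ℝ) : EReal))
    atTop < ⊤

/-- The coefficients
`b_α^{(m)} = ∑_{γ_1 ⋯ γ_p = α, |γ_s| ≥ 1} a_{γ_1} ⋯ a_{γ_p} (p + m - 1 choose m - 1)`, `m ≥ 1`.
The factorizations of `α` into nonempty words are indexed by the compositions of `|α|`. The empty
word has exactly one (with `p = 0`), so that `b_{g_0}^{(m)} = 1`. -/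
def bCoeff {n : ℕ} (f : PosRegular n) (m : ℕ) (α : List (Fin n)) : ℝ :=
  ∑ c : Composition α.length,
    ((α.splitWrtComposition c).map f.coeff).prod * ((c.length + m - 1).choose (m - 1) : ℝ)

theorem bCoeff_nil {n : ℕ} (f : PosRegular n) (m : ℕ) : bCoeff f m [] = 1 := by
  have h : ∀ c : Composition 0, c.blocks = [] := fun c => by
    have := c.blocks_sum
    rcases hb : c.blocks with _ | ⟨x, l⟩
    · rfl
    · have hx := c.blocks_pos (i := x) (by simp [hb])
      rw [hb] at this
      simp at this
      omega
  unfold bCoeff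
  refine (Fintype.sum_eq_single (default : Composition ([] : List (Fin n)).length) ?_).trans ?_
  rotate_left
  · have h' : (default : Composition ([] : List (Fin n)).length).blocks = [] := h _
    simp [List.splitWrtComposition, h', List.splitWrtCompositionAux, Composition.length]
  · intro c hc
    exact absurd (Composition.ext ((h c).trans (h default).symm)) hc

theorem mul_bCoeff_le {n : ℕ} (f : PosRegular n) (m : ℕ) (j : Fin n) (α : List (Fin n)) :
    f.coeff [j] * bCoeff f m α ≤ bCoeff f m (j :: α) := by
  let φ : Composition α.length → Composition (j :: α).length := fun c =>
    ⟨1 :: c.blocks, by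
      intro i hi
      rcases List.mem_cons.1 hi with rfl | hi
      · exact Nat.one_pos
      · exact c.blocks_pos hi, by simp [c.blocks_sum, add_comm]⟩
  have hφ : Function.Injective φ := by
    intro c d h
    have := congrArg Composition.blocks h
    exact Composition.ext (by simpa [φ] using this)
  have hprod : ∀ L : List (List (Fin n)), 0 ≤ (L.map f.coeff).prod := fun L =>
    List.prod_nonneg (by
      intro a ha
      obtain ⟨γ, -, rfl⟩ := List.mem_map.1 ha
      exact f.coeff_nonneg γ)
  unfold bCoeff
  rw [Finset.mul_sum]
  calc
    _ ≤ ∑ c : Composition α.length,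
        ((((j :: α).splitWrtComposition (φ c)).map f.coeff).prod
          * (((φ c).length + m - 1).choose (m - 1) : ℝ)) := by
      refine Finset.sum_le_sum fun c _ => ?_
      have h1 : (j :: α).splitWrtComposition (φ c) = [j] :: α.splitWrtComposition c := by
        simp [List.splitWrtComposition, φ, List.splitWrtCompositionAux_cons]
      have h2 : (φ c).length = c.length + 1 := by simp [φ, Composition.length]
      rw [h1, h2, List.map_cons, List.prod_cons, mul_assoc]
      refine mul_le_mul_of_nonneg_left ?_ (f.coeff_nonneg _)
      refine mul_le_mul_of_nonneg_left ?_ (hprod _)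
      exact_mod_cast Nat.choose_le_choose _ (by omega)
    _ = ∑ c ∈ Finset.univ.image φ,
        (((j :: α).splitWrtComposition c).map f.coeff).prod
          * ((c.length + m - 1).choose (m - 1) : ℝ) :=
      (Finset.sum_image (f := fun c : Composition (j :: α).length =>
        (((j :: α).splitWrtComposition c).map f.coeff).prod
          * ((c.length + m - 1).choose (m - 1) : ℝ)) (fun _ _ _ _ h => hφ h)).symm
    _ ≤ _ := Finset.sum_le_sum_of_subset_of_nonneg (Finset.subset_univ _)
      (fun c _ _ => mul_nonneg (hprod _) (Nat.cast_nonneg _))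

theorem bCoeff_pos {n : ℕ} (f : PosRegular n) (m : ℕ) (α : List (Fin n)) : 0 < bCoeff f m α := by
  induction α with
  | nil => rw [bCoeff_nil]; exact one_pos
  | cons j α ih => exact (mul_pos (f.coeff_letter_pos j) ih).trans_le (mul_bCoeff_le f m j α)

/-- The weight `√b_α^{(m)} / √b_{g_j α}^{(m)}`. -/
def weight {n : ℕ} (f : PosRegular n) (m : ℕ) (j : Fin n) (α : List (Fin n)) : ℝ :=
  √(bCoeff f m α) / √(bCoeff f m (j :: α))

theorem weight_nonneg {n : ℕ} (f : PosRegular n) (m : ℕ) (j : Fin n) (α : List (Fin n)) :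
    0 ≤ weight f m j α := div_nonneg (Real.sqrt_nonneg _) (Real.sqrt_nonneg _)

theorem weight_le {n : ℕ} (f : PosRegular n) (m : ℕ) (j : Fin n) (α : List (Fin n)) :
    weight f m j α ≤ (√(f.coeff [j]))⁻¹ := by
  unfold weight
  rw [← Real.sqrt_div (bCoeff_pos f m α).le, ← Real.sqrt_inv]
  refine Real.sqrt_le_sqrt ?_
  rw [div_le_iff₀ (bCoeff_pos f m _), inv_mul_eq_div, le_div_iff₀ (f.coeff_letter_pos j), mul_comm]
  exact mul_bCoeff_le f m j α

/-! ### The maps `Φ_{f,X}` and the noncommutative polydomain -/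

section Domain

variable {H : Type u} [NormedAddCommGroup H] [InnerProductSpace ℂ H] [CompleteSpace H]

/-- `X_α = X_{j_1} ⋯ X_{j_p}` for `α = g_{j_1} ⋯ g_{j_p}`, and `X_{g_0} = I`. -/
def wordOp {n : ℕ} (X : Fin n → H →L[ℂ] H) (α : List (Fin n)) : H →L[ℂ] H :=
  (α.map X).prod

/-- The terms `a_α X_α Y X_α^*`, in `B(H)` with the weak operator topology. -/
def phiTerm {n : ℕ} (f : PosRegular n) (X : Fin n → H →L[ℂ] H) (Y : H →L[ℂ] H)
    (α : List (Fin n)) : H →WOT[ℂ] H :=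
  ContinuousLinearMapWOT.ofCLM ((f.coeff α : ℂ) • (wordOp X α * Y * adjoint (wordOp X α)))

/-- `Φ_{f,X}(Y) = ∑_α a_α X_α Y X_α^*`, a sum in the weak operator topology. (The empty word
contributes `0`.) -/
def phi {n : ℕ} (f : PosRegular n) (X : Fin n → H →L[ℂ] H) (Y : H →L[ℂ] H) : H →L[ℂ] H :=
  (∑' α, phiTerm f X Y α).toCLM

/-- The defect mapping
`Δ_{f,X}^p = (id - Φ_{f_1,X_1})^{p_1} ∘ ⋯ ∘ (id - Φ_{f_k,X_k})^{p_k}` on `B(H)`. -/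
def defectMap {k : ℕ} {n : Fin k → ℕ} (f : ∀ i, PosRegular (n i))
    (X : ∀ i, Fin (n i) → H →L[ℂ] H) (p : Fin k → ℕ) (Y : H →L[ℂ] H) : H →L[ℂ] H :=
  (List.finRange k).foldr (fun i Z => (fun V => V - phi (f i) (X i) V)^[p i] Z) Y

/-- Membership of the `k`-tuple `X` in the noncommutative polydomain `D_f^m(H)`: the entries of
`X_i` commute with those of `X_{i'}` for `i ≠ i'`, each `Φ_{f_i,X_i}(I)` exists and is at most `I`,
and `Δ_{f,X}^{(ε_1 m_1, …, ε_k m_k)}(I) ≥ 0` for all `ε ∈ {0,1}^k`. -/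
structure MemPolydomain {k : ℕ} {n : Fin k → ℕ} (f : ∀ i, PosRegular (n i)) (m : Fin k → ℕ)
    (X : ∀ i, Fin (n i) → H →L[ℂ] H) : Prop where
  commute : ∀ i i', i ≠ i' → ∀ j j', Commute (X i j) (X i' j')
  summable : ∀ i, Summable (phiTerm (f i) (X i) 1)
  phi_le_one : ∀ i, phi (f i) (X i) 1 ≤ 1
  defect_nonneg : ∀ ε : Fin k → Fin 2, 0 ≤ defectMap f X (fun i => (ε i : ℕ) * m i) 1

/-- The closure of the range of an operator. -/
def closedRange (A : H →L[ℂ] H) : Submodule ℂ H :=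
  (LinearMap.range (A : H →ₗ[ℂ] H)).topologicalClosure

instance (A : H →L[ℂ] H) : CompleteSpace (closedRange A) :=
  inferInstanceAs (CompleteSpace (LinearMap.range (A : H →ₗ[ℂ] H)).topologicalClosure)

/-- The positive square root `A^{1/2}` of an operator `A ≥ 0`. -/
def opSqrt (A : H →L[ℂ] H) : H →L[ℂ] H := CFC.sqrt A

theorem sqrt_mem_closedRange (A : H →L[ℂ] H) (x : H) : opSqrt A x ∈ closedRange A := by
  unfold opSqrt
  by_cases hA : 0 ≤ A
  · have hs : IsSelfAdjoint (CFC.sqrt A) := (CFC.sqrt_nonneg A).isSelfAdjoint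
    have hsym : ∀ x y : H, inner ℂ (CFC.sqrt A x) y = inner ℂ x (CFC.sqrt A y) := fun x y => by
      rw [← ContinuousLinearMap.adjoint_inner_right, hs.adjoint_eq]
    have hsq : ∀ y, CFC.sqrt A (CFC.sqrt A y) = A y := fun y =>
      congrArg (fun B : H →L[ℂ] H => B y) (CFC.sqrt_mul_sqrt_self A hA)
    unfold closedRange
    rw [← Submodule.orthogonal_orthogonal_eq_closure, Submodule.mem_orthogonal]
    intro y hy
    have h0 : inner ℂ (A y) y = 0 := hy (A y) ⟨y, rfl⟩
    rw [← hsq, hsym, inner_self_eq_zero] at h0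
    rw [← inner_conj_symm, hsym, h0, inner_zero_right, map_zero]
  · have : CFC.sqrt A = 0 := cfcₙ_apply_of_not_predicate A hA
    rw [this]
    exact Submodule.zero_mem _

/-- `A^{1/2}`, for `A ≥ 0`, as an operator into the closure of the range of `A`. -/
def sqrtInto (A : H →L[ℂ] H) : H →L[ℂ] closedRange A :=
  (opSqrt A).codRestrict (closedRange A) (sqrt_mem_closedRange A)

end Domain

/-! ### The universal model and multi-analytic operators -/

section Fock

variable {k : ℕ} {n : Fin k → ℕ}

/-- The Hilbert space `F²(H_{n_1}) ⊗ ⋯ ⊗ F²(H_{n_k}) ⊗ E`, in the coordinates given by the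
orthonormal basis `e_β = e^1_{β_1} ⊗ ⋯ ⊗ e^k_{β_k}` of the first `k` factors: the vector
`∑_β e_β ⊗ x_β` is the square summable family `(x_β)_β` in `E`, and `e_β ⊗ x` is
`lp.single 2 β x`. -/
abbrev FockTensor (n : Fin k → ℕ) (E : Type u) [NormedAddCommGroup E] [InnerProductSpace ℂ E] :
    Type u :=
  lp (fun _ : (∀ i, List (Fin (n i))) => E) 2

variable {E : Type u} [NormedAddCommGroup E] [InnerProductSpace ℂ E]

theorem update_cons_injective (i : Fin k) (j : Fin (n i)) :
    Function.Injective
      (fun β : (∀ i, List (Fin (n i))) => Function.update β i (j :: β i)) := by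
  intro β γ h
  funext l
  have hl := congrFun h l
  by_cases hli : l = i
  · subst hli
    simpa using hl
  · simpa [Function.update_of_ne hli] using hl

/-- The family `γ ↦ w_γ x_{g_j γ}` (the letter `j` being put in front of the `i`-th word). -/
def backwardFun (f : ∀ i, PosRegular (n i)) (m : Fin k → ℕ) (i : Fin k) (j : Fin (n i))
    (x : (∀ i, List (Fin (n i))) → E) (γ : ∀ i, List (Fin (n i))) : E :=
  (weight (f i) (m i) j (γ i) : ℂ) • x (Function.update γ i (j :: γ i))

theorem backwardFun_norm_sq_le (f : ∀ i, PosRegular (n i)) (m : Fin k → ℕ) (i : Fin k)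
    (j : Fin (n i)) (x : (∀ i, List (Fin (n i))) → E) (γ : ∀ i, List (Fin (n i))) :
    ‖backwardFun f m i j x γ‖ ^ (2 : ℝ)
      ≤ (√((f i).coeff [j]))⁻¹ ^ (2 : ℝ) * ‖x (Function.update γ i (j :: γ i))‖ ^ (2 : ℝ) := by
  rw [← Real.mul_rpow (by positivity) (norm_nonneg _)]
  refine Real.rpow_le_rpow (norm_nonneg _) ?_ (by norm_num)
  rw [backwardFun, norm_smul, Complex.norm_real, Real.norm_of_nonneg (weight_nonneg _ _ _ _)]
  exact mul_le_mul_of_nonneg_right (weight_le _ _ _ _) (norm_nonneg _)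

theorem backwardFun_summable (f : ∀ i, PosRegular (n i)) (i : Fin k)
    (j : Fin (n i)) (x : FockTensor n E) :
    Summable (fun γ => (√((f i).coeff [j]))⁻¹ ^ (2 : ℝ)
      * ‖x (Function.update γ i (j :: γ i))‖ ^ (2 : ℝ)) := by
  have h : Summable fun β => ‖x β‖ ^ (2 : ℝ) := by
    simpa using (lp.hasSum_norm (p := 2) (by norm_num) x).summable
  exact (h.comp_injective (update_cons_injective i j)).mul_left _

theorem backwardFun_memℓp (f : ∀ i, PosRegular (n i)) (m : Fin k → ℕ) (i : Fin k)
    (j : Fin (n i)) (x : FockTensor n E) : Memℓp (backwardFun f m i j x) 2 := by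
  refine memℓp_gen ?_
  simp only [ENNReal.toReal_ofNat]
  exact Summable.of_nonneg_of_le (fun γ => by positivity)
    (fun γ => backwardFun_norm_sq_le f m i j x γ) (backwardFun_summable f i j x)

/-- The weighted backward shift `e_{g_j γ} ⊗ x ↦ w_γ e_γ ⊗ x`, the adjoint of the universal
model. -/
def backwardShift (f : ∀ i, PosRegular (n i)) (m : Fin k → ℕ) (i : Fin k) (j : Fin (n i)) :
    FockTensor n E →L[ℂ] FockTensor n E :=
  LinearMap.mkContinuous
    { toFun := fun x => ⟨backwardFun f m i j x, backwardFun_memℓp f m i j x⟩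
      map_add' := fun x y => by ext γ; exact smul_add _ _ _
      map_smul' := fun c x => by ext γ; exact smul_comm _ _ _ }
    (√((f i).coeff [j]))⁻¹ (fun x => by
      have hx : HasSum (fun β => ‖x β‖ ^ (2 : ℝ)) (‖x‖ ^ (2 : ℝ)) := by
        simpa using lp.hasSum_norm (p := 2) (by norm_num) x
      set z : FockTensor n E := ⟨backwardFun f m i j x, backwardFun_memℓp f m i j x⟩ with hz
      have hzs : HasSum (fun β => ‖z β‖ ^ (2 : ℝ)) (‖z‖ ^ (2 : ℝ)) := by
        simpa using lp.hasSum_norm (p := 2) (by norm_num) z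
      have h1 : ‖z‖ ^ (2 : ℝ) ≤ ((√((f i).coeff [j]))⁻¹ * ‖x‖) ^ (2 : ℝ) := by
        rw [Real.mul_rpow (by positivity) (norm_nonneg _), ← hzs.tsum_eq, ← hx.tsum_eq]
        refine (hzs.summable.tsum_le_tsum (fun γ => backwardFun_norm_sq_le f m i j x γ)
          (backwardFun_summable f i j x)).trans ?_
        rw [tsum_mul_left]
        refine mul_le_mul_of_nonneg_left ?_ (by positivity)
        exact tsum_comp_le_tsum_of_inj hx.summable (fun β => by positivity)
          (update_cons_injective i j)
      exact (Real.rpow_le_rpow_iff (norm_nonneg _) (by positivity) (by norm_num)).1 h1)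

variable [CompleteSpace E]

/-- The operator `W_{i,j} ⊗ I_E` of the universal model: it multiplies the `i`-th word by `g_j` on
the left, with weight; see `universalModel_single`. -/
def universalModel (f : ∀ i, PosRegular (n i)) (m : Fin k → ℕ) (E : Type u)
    [NormedAddCommGroup E] [InnerProductSpace ℂ E] [CompleteSpace E]
    (i : Fin k) (j : Fin (n i)) : FockTensor n E →L[ℂ] FockTensor n E :=
  adjoint (backwardShift f m i j)

/-- `(W_{i,j} ⊗ I)(e_β ⊗ x) = (√b_{i,β_i}^{(m_i)} / √b_{i,g_j β_i}^{(m_i)}) e_{β'} ⊗ x`, where `β'`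
is `β` with its `i`-th word `β_i` replaced by `g_j β_i`. -/
theorem universalModel_single (f : ∀ i, PosRegular (n i)) (m : Fin k → ℕ)
    (i : Fin k) (j : Fin (n i)) (β : ∀ i, List (Fin (n i))) (x : E) :
    universalModel f m E i j (lp.single 2 β x)
      = ((√(bCoeff (f i) (m i) (β i)) / √(bCoeff (f i) (m i) (j :: β i)) : ℝ) : ℂ)
        • lp.single 2 (Function.update β i (j :: β i)) x := by
  refine ext_inner_right ℂ fun y => ?_
  rw [universalModel, adjoint_inner_left, lp.inner_single_left, inner_smul_left,
    lp.inner_single_left]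
  change inner ℂ x (backwardFun f m i j y β) = _
  rw [backwardFun, inner_smul_right, Complex.conj_ofReal]
  rfl

/-- A bounded operator `M` is multi-analytic if `M (W_{i,j} ⊗ I) = (W_{i,j} ⊗ I) M` for all
`i, j`. -/
def IsMultiAnalytic {G : Type u} [NormedAddCommGroup G] [InnerProductSpace ℂ G] [CompleteSpace G]
    (f : ∀ i, PosRegular (n i)) (m : Fin k → ℕ) (M : FockTensor n E →L[ℂ] FockTensor n G) : Prop :=
  ∀ i j, M ∘L universalModel f m E i j = universalModel f m G i j ∘L M

end Fock

/-! ### The Berezin kernel and the characteristic function -/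

section Kernel

variable {k : ℕ} {n : Fin k → ℕ} {H : Type u} [NormedAddCommGroup H] [InnerProductSpace ℂ H]
  [CompleteSpace H]

/-- The closure of the range of the defect operator `Δ_{f,T}^m(I)`. -/
abbrev defectSpace (f : ∀ i, PosRegular (n i)) (m : Fin k → ℕ)
    (T : ∀ i, Fin (n i) → H →L[ℂ] H) : Submodule ℂ H :=
  closedRange (defectMap f T m 1)

/-- `K` is the Berezin kernel of `T`:
`K h = ∑_β √b_{1,β_1}^{(m_1)} ⋯ √b_{k,β_k}^{(m_k)} e_β ⊗ Δ_{f,T}^m(I)^{1/2} T_{1,β_1}^* ⋯ T_{k,β_k}^* h`.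
-/
def IsBerezinKernel (f : ∀ i, PosRegular (n i)) (m : Fin k → ℕ) (T : ∀ i, Fin (n i) → H →L[ℂ] H)
    (K : H →L[ℂ] FockTensor n (defectSpace f m T)) : Prop :=
  ∀ (h : H) (β : ∀ i, List (Fin (n i))),
    K h β = ((∏ i, √(bCoeff (f i) (m i) (β i)) : ℝ) : ℂ) •
      sqrtInto (defectMap f T m 1)
        (((List.finRange k).map fun i => adjoint (wordOp (T i) (β i))).prod h)

open Classical in
/-- The Berezin kernel `K_{f,T}`: the bounded operator given by the formula of `IsBerezinKernel`.
(At most one operator satisfies this formula. The value `0` is a placeholder for tuples outside the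
polydomain.) -/
def berezinKernel (f : ∀ i, PosRegular (n i)) (m : Fin k → ℕ) (T : ∀ i, Fin (n i) → H →L[ℂ] H) :
    H →L[ℂ] FockTensor n (defectSpace f m T) :=
  if h : ∃ K, IsBerezinKernel f m T K then h.choose else 0

/-- The operator `I - K_{f,T} K_{f,T}^*`. -/
def kernelDefect (f : ∀ i, PosRegular (n i)) (m : Fin k → ℕ) (T : ∀ i, Fin (n i) → H →L[ℂ] H) :
    FockTensor n (defectSpace f m T) →L[ℂ] FockTensor n (defectSpace f m T) :=
  1 - berezinKernel f m T ∘L adjoint (berezinKernel f m T)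

/-- `T` has a characteristic function: there are a Hilbert space `E` and a multi-analytic operator
`Ψ` with `K_{f,T} K_{f,T}^* + Ψ Ψ^* = I`. -/
def HasCharacteristicFunction (f : ∀ i, PosRegular (n i)) (m : Fin k → ℕ)
    (T : ∀ i, Fin (n i) → H →L[ℂ] H) : Prop :=
  ∃ (E : Type u) (_ : NormedAddCommGroup E) (_ : InnerProductSpace ℂ E) (_ : CompleteSpace E)
    (Ψ : FockTensor n E →L[ℂ] FockTensor n (defectSpace f m T)),
    IsMultiAnalytic f m Ψ ∧
      berezinKernel f m T ∘L adjoint (berezinKernel f m T) + Ψ ∘L adjoint Ψ = 1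

/-- The space `M_T`, the closure of the range of `I - K_{f,T} K_{f,T}^*`. -/
abbrev modelSpace (f : ∀ i, PosRegular (n i)) (m : Fin k → ℕ) (T : ∀ i, Fin (n i) → H →L[ℂ] H) :
    Submodule ℂ (FockTensor n (defectSpace f m T)) :=
  closedRange (kernelDefect f m T)

/-- `A` is the operator `A_{i,j}` on `M_T`, which is given by
`A (I - K K^*)^{1/2} x = (I - K K^*)^{1/2} (W_{i,j}^* ⊗ I) x`. -/
def IsModelAdjoint (f : ∀ i, PosRegular (n i)) (m : Fin k → ℕ) (T : ∀ i, Fin (n i) → H →L[ℂ] H)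
    (i : Fin k) (j : Fin (n i)) (A : modelSpace f m T →L[ℂ] modelSpace f m T) : Prop :=
  ∀ x : FockTensor n (defectSpace f m T),
    A (sqrtInto (kernelDefect f m T) x) =
      sqrtInto (kernelDefect f m T) (adjoint (universalModel f m (defectSpace f m T) i j) x)

open Classical in
/-- The `k`-tuple `M_T` of operators `M_{i,j} = A_{i,j}^*` on the space `M_T`. (The placeholder `0`
is used when `A_{i,j}` does not exist as a bounded operator.) -/
def modelTuple (f : ∀ i, PosRegular (n i)) (m : Fin k → ℕ) (T : ∀ i, Fin (n i) → H →L[ℂ] H)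
    (i : Fin k) (j : Fin (n i)) : modelSpace f m T →L[ℂ] modelSpace f m T :=
  if h : ∃ A, IsModelAdjoint f m T i j A then adjoint h.choose else 0

/-- The operator `Θ_{f,T} = (I - K_{f,T} K_{f,T}^*)^{1/2} K_{f,M_T}^*`. -/
def theta (f : ∀ i, PosRegular (n i)) (m : Fin k → ℕ) (T : ∀ i, Fin (n i) → H →L[ℂ] H) :
    FockTensor n (defectSpace f m (modelTuple f m T)) →L[ℂ] FockTensor n (defectSpace f m T) :=
  (opSqrt (kernelDefect f m T) ∘L (modelSpace f m T).subtypeL) ∘L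
    adjoint (berezinKernel f m (modelTuple f m T))

end Kernel

end

end NCPolydomain

open NCPolydomain

/-!
The coefficients `b^(m)` are those of `(1 - f)^(-m)`, which makes `Δ^p(I)` for the universal model a
nonnegative diagonal operator; hence `W` lies in the polydomain, and so do its ampliations.
If `Y = R^* R` satisfies `Δ^p(Y) ≥ 0` for all `p ≤ m`, then `Φ_i(Y) ≤ Y`, so `R W_{i,j}^*` factors
through `R`: there is a tuple `X` with `X_{i,j}^* R = R W_{i,j}^*`. Conjugation by `R` carries the
defects of `X` to those of `Y`, so `X` lies in the polydomain. Long words in the `X_{i,j}^*` kill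
the images under `R` of the finitely supported vectors, which forces the Berezin kernel `K` of `X`
to be isometric. Then `Θ = R^* K^*` is multi-analytic and `Θ Θ^* = R^* R = Y`.
Conversely, `Δ^p` commutes with conjugation by a multi-analytic `Ψ`, so that
`Δ^p(Ψ Ψ^*) = Ψ Δ^p(I) Ψ^* ≥ 0`.
-/

namespace NCPolydomain

universe u

/-! ### Factorizations of words -/

section Words

variable {ι : Type*}

theorem take_drop_injective (β : List ι) :
    Function.Injective fun s : Fin (β.length + 1) => (β.take s, β.drop s) := by
  intro s t h
  have hlen := congrArg List.length (congrArg Prod.fst h)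
  simp only [List.length_take] at hlen
  omega

/-- The factorizations `β = αγ` of a word into two words, as pairs `(α, γ)`. -/
def splits (β : List ι) : Finset (List ι × List ι) :=
  Finset.univ.map ⟨_, take_drop_injective β⟩

theorem mem_splits {β : List ι} {p : List ι × List ι} : p ∈ splits β ↔ p.1 ++ p.2 = β := by
  simp only [splits, Finset.mem_map, Finset.mem_univ, true_and, Function.Embedding.coeFn_mk]
  constructor
  · rintro ⟨s, rfl⟩
    exact List.take_append_drop _ _
  · rintro rfl
    exact ⟨⟨p.1.length, by rw [List.length_append]; omega⟩, by simp⟩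

theorem sum_splits_assoc {M : Type*} [AddCommMonoid M] (β : List ι)
    (g : List ι → List ι → List ι → M) :
    ∑ p ∈ splits β, ∑ q ∈ splits p.1, g q.1 q.2 p.2
      = ∑ p ∈ splits β, ∑ q ∈ splits p.2, g p.1 q.1 q.2 := by
  simp only [Finset.sum_sigma']
  refine Finset.sum_bij' (fun x _ => ⟨(x.2.1, x.2.2 ++ x.1.2), (x.2.2, x.1.2)⟩)
    (fun x _ => ⟨(x.1.1 ++ x.2.1, x.2.2), (x.1.1, x.2.1)⟩) ?_ ?_ ?_ ?_ fun _ _ => rfl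
  all_goals
    rintro ⟨⟨a, b⟩, c, d⟩ h
    simp only [Finset.mem_sigma, mem_splits] at h ⊢
    obtain ⟨rfl, rfl⟩ := h
    simp

theorem sum_splits_of_forall_ne_left {M : Type*} [AddCommMonoid M] (β : List ι)
    (g : List ι × List ι → M) (hg : ∀ p, p.1 ≠ [] → g p = 0) :
    ∑ p ∈ splits β, g p = g ([], β) := by
  refine Finset.sum_eq_single_of_mem _ (mem_splits.2 rfl) fun p hp hne => hg p fun h => hne ?_
  rw [mem_splits, h, List.nil_append] at hp
  exact Prod.ext h hp

theorem sum_splits_of_forall_ne_right {M : Type*} [AddCommMonoid M] (β : List ι)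
    (g : List ι × List ι → M) (hg : ∀ p, p.2 ≠ [] → g p = 0) :
    ∑ p ∈ splits β, g p = g (β, []) := by
  refine Finset.sum_eq_single_of_mem _ (mem_splits.2 (List.append_nil β)) fun p hp hne =>
    hg p fun h => hne ?_
  rw [mem_splits, h, List.append_nil] at hp
  exact Prod.ext hp h

theorem splitWrtComposition_injective (β : List ι) :
    Function.Injective (β.splitWrtComposition (n := β.length)) := fun c d h => Composition.ext <| by
  rw [← List.map_length_splitWrtComposition β c, h, List.map_length_splitWrtComposition]

/-- The factorizations of a word into nonempty words. -/
def factorizations (β : List ι) : Finset (List (List ι)) :=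
  Finset.univ.map ⟨_, splitWrtComposition_injective β⟩

theorem mem_factorizations {β : List ι} {L : List (List ι)} :
    L ∈ factorizations β ↔ L.flatten = β ∧ [] ∉ L := by
  simp only [factorizations, Finset.mem_map, Finset.mem_univ, true_and,
    Function.Embedding.coeFn_mk]
  constructor
  · rintro ⟨c, rfl⟩
    exact ⟨List.flatten_splitWrtComposition _ _, fun h =>
      absurd (List.length_pos_of_mem_splitWrtComposition h) (lt_irrefl 0)⟩
  · rintro ⟨rfl, hL⟩
    refine ⟨⟨L.map List.length, fun {i} hi => ?_, List.length_flatten.symm⟩,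
      List.splitWrtComposition_flatten L _ rfl⟩
    obtain ⟨α, hα, rfl⟩ := List.mem_map.1 hi
    exact List.length_pos_iff.2 (ne_of_mem_of_not_mem hα hL)

theorem factorizations_nil : factorizations ([] : List ι) = {[]} := by
  ext L
  rw [mem_factorizations, Finset.mem_singleton, List.flatten_eq_nil_iff]
  refine ⟨fun ⟨hnil, hL⟩ => List.eq_nil_iff_forall_not_mem.2 fun α hα => hL ?_, ?_⟩
  · rwa [← hnil α hα]
  · rintro rfl
    simp

theorem sum_factorizations_of_ne_nil {M : Type*} [AddCommMonoid M] {β : List ι} (hβ : β ≠ [])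
    (g : List (List ι) → M) :
    ∑ L ∈ factorizations β, g L
      = ∑ p ∈ splits β with p.1 ≠ [], ∑ L ∈ factorizations p.2, g (p.1 :: L) := by
  rw [Finset.sum_sigma']
  symm
  refine Finset.sum_bij (fun x _ => x.1.1 :: x.2) ?_ ?_ ?_ fun _ _ => rfl
  · rintro ⟨⟨α, γ⟩, L⟩ h
    simp only [Finset.mem_sigma, Finset.mem_filter, mem_splits, mem_factorizations] at h ⊢
    obtain ⟨⟨rfl, hα⟩, rfl, hL⟩ := h
    exact ⟨List.flatten_cons, fun h => (List.mem_cons.1 h).elim (hα ·.symm) hL⟩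
  · rintro ⟨⟨α, γ⟩, L⟩ h ⟨⟨α', γ'⟩, L'⟩ h' heq
    simp only [Finset.mem_sigma, mem_factorizations] at h h'
    obtain ⟨rfl, rfl⟩ := List.cons.inj heq
    obtain rfl := h.2.1.symm.trans h'.2.1
    rfl
  · intro L hL
    rw [mem_factorizations] at hL
    obtain ⟨rfl, hL⟩ := hL
    obtain _ | ⟨α, L⟩ := L
    · exact absurd rfl hβ
    · rw [List.mem_cons, not_or] at hL
      refine ⟨⟨(α, L.flatten), L⟩, ?_, rfl⟩
      simp only [Finset.mem_sigma, Finset.mem_filter, mem_splits, mem_factorizations]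
      exact ⟨⟨List.flatten_cons.symm, Ne.symm hL.1⟩, trivial, hL.2⟩

/-- The words of length at most `N`. -/
noncomputable def words (ι : Type*) [Finite ι] (N : ℕ) : Finset (List ι) :=
  (List.finite_length_le ι N).toFinset

theorem mem_words [Finite ι] {N : ℕ} {α : List ι} : α ∈ words ι N ↔ α.length ≤ N := by
  simp [words]

theorem sum_words_splits {M : Type*} [AddCommMonoid M] [Finite ι] (N : ℕ)
    (g : List ι → List ι → M) :
    ∑ β ∈ words ι N, ∑ p ∈ splits β, g p.1 p.2
      = ∑ α ∈ words ι N, ∑ γ ∈ words ι (N - α.length), g α γ := by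
  simp only [Finset.sum_sigma']
  refine Finset.sum_bij' (fun x _ => ⟨x.2.1, x.2.2⟩)
    (fun x _ => ⟨x.1 ++ x.2, (x.1, x.2)⟩) ?_ ?_ ?_ (fun _ _ => rfl) fun _ _ => rfl
  · rintro ⟨β, α, γ⟩ h
    simp only [Finset.mem_sigma, mem_splits, mem_words] at h ⊢
    obtain ⟨h, rfl⟩ := h
    rw [List.length_append] at h
    omega
  · rintro ⟨α, γ⟩ h
    simp only [Finset.mem_sigma, mem_splits, mem_words, List.length_append] at h ⊢
    exact ⟨by omega, trivial⟩
  · rintro ⟨β, α, γ⟩ h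
    simp only [Finset.mem_sigma, mem_splits] at h
    obtain ⟨-, rfl⟩ := h
    rfl

theorem hasSum_prefix {M : Type*} [AddCommMonoid M] [TopologicalSpace M] [DecidableEq ι]
    (β : List ι) (g : List ι → List ι → M) :
    HasSum (fun α => if α <+: β then g α (β.drop α.length) else 0)
      (∑ p ∈ splits β, g p.1 p.2) := by
  have hinj : Set.InjOn Prod.fst (splits β : Set (List ι × List ι)) := by
    rintro ⟨α, γ⟩ hp ⟨α', γ'⟩ hp' rfl
    rw [Finset.mem_coe, mem_splits] at hp hp'
    exact Prod.ext rfl (List.append_cancel_left (hp.trans hp'.symm))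
  have hsum : ∑ α ∈ (splits β).image Prod.fst, (if α <+: β then g α (β.drop α.length) else 0)
      = ∑ p ∈ splits β, g p.1 p.2 := by
    rw [Finset.sum_image hinj]
    refine Finset.sum_congr rfl fun p hp => ?_
    rw [mem_splits] at hp
    subst hp
    simp
  rw [← hsum]
  refine hasSum_sum_of_ne_finset_zero fun α hα => if_neg fun ⟨γ, h⟩ => hα ?_
  exact Finset.mem_image.2 ⟨(α, γ), mem_splits.2 h, rfl⟩

end Words

/-! ### Formal power series in noncommuting variables -/

/-- Formal power series in noncommuting variables indexed by `ι`: families of coefficients indexed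
by words, multiplied by convolution along the factorizations of words. -/
def NCSeries (ι R : Type*) : Type _ := List ι → R

namespace NCSeries

variable {ι R : Type*} [Ring R]

instance : AddCommGroup (NCSeries ι R) := inferInstanceAs (AddCommGroup (List ι → R))

instance : Mul (NCSeries ι R) := ⟨fun x y β => ∑ p ∈ splits β, x p.1 * y p.2⟩

instance : One (NCSeries ι R) := ⟨fun β => if β.isEmpty then 1 else 0⟩

theorem mul_apply (x y : NCSeries ι R) (β : List ι) :
    (x * y) β = ∑ p ∈ splits β, x p.1 * y p.2 := rfl

theorem add_apply (x y : NCSeries ι R) (β : List ι) : (x + y) β = x β + y β := rfl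

theorem one_nil : (1 : NCSeries ι R) [] = 1 := rfl

theorem one_apply_of_ne_nil {β : List ι} (hβ : β ≠ []) : (1 : NCSeries ι R) β = 0 :=
  if_neg (by simpa using hβ)

instance : Ring (NCSeries ι R) where
  __ := (inferInstance : AddCommGroup (NCSeries ι R))
  left_distrib x y z := funext fun β => by
    simp only [mul_apply, add_apply, mul_add, Finset.sum_add_distrib]
  right_distrib x y z := funext fun β => by
    simp only [mul_apply, add_apply, add_mul, Finset.sum_add_distrib]
  zero_mul x := funext fun β => Finset.sum_eq_zero fun p _ => zero_mul (x p.2)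
  mul_zero x := funext fun β => Finset.sum_eq_zero fun p _ => mul_zero (x p.1)
  mul_assoc x y z := funext fun β => by
    simpa only [mul_apply, Finset.sum_mul, Finset.mul_sum, mul_assoc] using
      sum_splits_assoc β fun a b c => x a * y b * z c
  one_mul x := funext fun β => by
    rw [mul_apply, sum_splits_of_forall_ne_left, one_nil, one_mul]
    intro p hp
    rw [one_apply_of_ne_nil hp, zero_mul]
  mul_one x := funext fun β => by
    rw [mul_apply, sum_splits_of_forall_ne_right, one_nil, mul_one]
    intro p hp
    rw [one_apply_of_ne_nil hp, mul_zero]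

theorem eq_zero_of_mul_left_eq_self {f x : NCSeries ι R} (hf : f [] = 0) (h : f * x = x) :
    x = 0 := by
  suffices ∀ N (β : List ι), β.length < N → x β = 0 from
    funext fun β => this _ β (Nat.lt_succ_self _)
  intro N
  induction N with
  | zero => exact fun β hβ => absurd hβ (Nat.not_lt_zero _)
  | succ N ih =>
    intro β hβ
    rw [← h, mul_apply]
    refine Finset.sum_eq_zero fun ⟨α, γ⟩ hp => ?_
    rw [mem_splits] at hp
    obtain rfl := hp
    rcases eq_or_ne α [] with rfl | hα
    · exact mul_eq_zero_of_left hf _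
    · have := List.length_pos_iff.2 hα
      simp only [List.length_append] at hβ
      exact mul_eq_zero_of_right _ (ih γ (by omega))

theorem one_sub_mul_left_cancel {f x y : NCSeries ι R} (hf : f [] = 0)
    (h : (1 - f) * x = (1 - f) * y) : x = y := by
  refine sub_eq_zero.1 (eq_zero_of_mul_left_eq_self hf ?_)
  rw [← sub_eq_zero, ← mul_sub, sub_mul, one_mul] at h
  exact (sub_eq_zero.1 h).symm

/-- The substitution of `f` into the one-variable series `∑_q w_q z^q`. -/
def substInto (w : ℕ → R) (f : NCSeries ι R) : NCSeries ι R :=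
  fun β => ∑ L ∈ factorizations β, (L.map f).prod * w L.length

theorem substInto_nil (w : ℕ → R) (f : NCSeries ι R) : substInto w f [] = w 0 := by
  rw [substInto, factorizations_nil, Finset.sum_singleton]
  exact one_mul (w 0)

theorem substInto_of_ne_nil {f : NCSeries ι R} (hf : f [] = 0) (w : ℕ → R) {β : List ι}
    (hβ : β ≠ []) : substInto w f β = (f * substInto (fun q => w (q + 1)) f) β := by
  rw [substInto, sum_factorizations_of_ne_nil hβ, mul_apply, Finset.sum_filter]
  refine Finset.sum_congr rfl fun p _ => ?_
  split_ifs with hp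
  · rw [substInto, Finset.mul_sum]
    refine Finset.sum_congr rfl fun L _ => ?_
    rw [← mul_assoc]
    exact congrArg (· * _) List.prod_cons
  · rw [not_not.1 hp, hf, zero_mul]

theorem substInto_add (w w' : ℕ → R) (f : NCSeries ι R) :
    substInto (w + w') f = substInto w f + substInto w' f :=
  funext fun β => by
    simp only [substInto, add_apply, Pi.add_apply, mul_add, Finset.sum_add_distrib]

/-- The power series `(1 - f)^{-m}`, by the binomial series (assuming that `f` has no constant
term). -/
def invOneSubPow (m : ℕ) (f : NCSeries ι R) : NCSeries ι R :=
  substInto (fun q => (m.multichoose q : R)) f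

variable {f : NCSeries ι R}

theorem invOneSubPow_nil (m : ℕ) : invOneSubPow m f [] = 1 := by
  simp [invOneSubPow, substInto_nil]

theorem invOneSubPow_zero : invOneSubPow 0 f = 1 := by
  funext β
  rcases eq_or_ne β [] with rfl | hβ
  · exact invOneSubPow_nil 0
  · rw [one_apply_of_ne_nil hβ, invOneSubPow, substInto]
    refine Finset.sum_eq_zero fun L hL => ?_
    obtain _ | ⟨α, L⟩ := L
    · exact absurd (mem_factorizations.1 hL).1.symm hβ
    · simp

theorem invOneSubPow_succ_eq_add_mul_left (hf : f [] = 0) (m : ℕ) :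
    invOneSubPow (m + 1) f = invOneSubPow m f + f * invOneSubPow (m + 1) f := by
  have hw : (fun q => ((m + 1).multichoose (q + 1) : R))
      = (fun q => (m.multichoose (q + 1) : R)) + fun q => ((m + 1).multichoose q : R) :=
    funext fun q => by simp [Nat.multichoose_succ_succ]
  funext β
  rcases eq_or_ne β [] with rfl | hβ
  · simp [add_apply, mul_apply, splits, invOneSubPow_nil, hf]
  · rw [add_apply, invOneSubPow, invOneSubPow, substInto_of_ne_nil hf _ hβ, hw, substInto_add,
      mul_add, substInto_of_ne_nil hf _ hβ, add_apply]

theorem one_sub_mul_invOneSubPow_succ (hf : f [] = 0) (m : ℕ) :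
    (1 - f) * invOneSubPow (m + 1) f = invOneSubPow m f := by
  rw [sub_mul, one_mul, sub_eq_iff_eq_add]
  exact invOneSubPow_succ_eq_add_mul_left hf m

theorem commute_one_sub_invOneSubPow (hf : f [] = 0) (m : ℕ) :
    Commute (1 - f) (invOneSubPow m f) := by
  induction m with
  | zero => rw [invOneSubPow_zero]; exact Commute.one_right _
  | succ m ih =>
    refine one_sub_mul_left_cancel hf ?_
    rw [← mul_assoc (1 - f) (invOneSubPow (m + 1) f), one_sub_mul_invOneSubPow_succ hf, ih.eq]

theorem invOneSubPow_succ_eq_add_mul_right (hf : f [] = 0) (m : ℕ) :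
    invOneSubPow (m + 1) f = invOneSubPow m f + invOneSubPow (m + 1) f * f := by
  have h := (commute_one_sub_invOneSubPow hf (m + 1)).eq
  rw [one_sub_mul_invOneSubPow_succ hf, mul_sub, mul_one] at h
  rw [h, sub_add_cancel]

end NCSeries

section InvCoeff

variable {n : ℕ} (f : PosRegular n)

/-- The coefficients of `(1 - f)^{-m}`. For `m ≥ 1` they are the `b_α^{(m)}`, see
`bCoeff_eq_invCoeff`; unlike `bCoeff f m`, they satisfy the recursion in `m` from `m = 0` on. -/
def invCoeff (m : ℕ) : NCSeries (Fin n) ℝ := NCSeries.invOneSubPow m f.coeff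

theorem bCoeff_eq_invCoeff {m : ℕ} (hm : 1 ≤ m) (β : List (Fin n)) :
    bCoeff f m β = invCoeff f m β := by
  refine Eq.trans (Finset.sum_congr rfl fun c _ => ?_) (Finset.sum_map Finset.univ
    ⟨_, splitWrtComposition_injective β⟩ _).symm
  simp only [Function.Embedding.coeFn_mk, List.length_splitWrtComposition]
  rw [Nat.multichoose_eq,
    show m + c.length - 1 = c.length + (m - 1) by omega,
    show c.length + m - 1 = c.length + (m - 1) by omega, ← Nat.choose_symm_add]

theorem invCoeff_nil (m : ℕ) : invCoeff f m [] = 1 := NCSeries.invOneSubPow_nil m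

theorem invCoeff_zero : invCoeff f 0 = 1 := NCSeries.invOneSubPow_zero

theorem invCoeff_nonneg (m : ℕ) (β : List (Fin n)) : 0 ≤ invCoeff f m β := by
  change 0 ≤ ∑ L ∈ factorizations β, (L.map f.coeff).prod * (m.multichoose L.length : ℝ)
  refine Finset.sum_nonneg fun L _ => mul_nonneg (List.prod_nonneg fun a ha => ?_) ?_
  · obtain ⟨α, -, rfl⟩ := List.mem_map.1 ha
    exact f.coeff_nonneg α
  · exact Nat.cast_nonneg _

theorem invCoeff_pos {m : ℕ} (hm : 1 ≤ m) (β : List (Fin n)) : 0 < invCoeff f m β :=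
  bCoeff_eq_invCoeff f hm β ▸ bCoeff_pos f m β

theorem invCoeff_succ_left (m : ℕ) (β : List (Fin n)) :
    invCoeff f (m + 1) β
      = invCoeff f m β + ∑ p ∈ splits β, f.coeff p.1 * invCoeff f (m + 1) p.2 :=
  congrFun (NCSeries.invOneSubPow_succ_eq_add_mul_left f.coeff_nil m) β

theorem invCoeff_succ_right (m : ℕ) (β : List (Fin n)) :
    invCoeff f (m + 1) β
      = invCoeff f m β + ∑ p ∈ splits β, invCoeff f (m + 1) p.1 * f.coeff p.2 :=
  congrFun (NCSeries.invOneSubPow_succ_eq_add_mul_right f.coeff_nil m) β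

end InvCoeff

/-! ### Quadratic forms and families of operators -/

section Forms

variable {𝕜 H : Type*} [RCLike 𝕜] [NormedAddCommGroup H] [InnerProductSpace 𝕜 H]

theorem reApplyInnerSelf_sub (V U : H →L[𝕜] H) (x : H) :
    (V - U).reApplyInnerSelf x = V.reApplyInnerSelf x - U.reApplyInnerSelf x := by
  simp only [reApplyInnerSelf_apply, sub_apply, inner_sub_left, map_sub]

theorem reApplyInnerSelf_one (x : H) : (1 : H →L[𝕜] H).reApplyInnerSelf x = ‖x‖ ^ 2 :=
  inner_self_eq_norm_sq x

theorem reApplyInnerSelf_zero_right (V : H →L[𝕜] H) : V.reApplyInnerSelf 0 = 0 := by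
  simp [reApplyInnerSelf_apply]

theorem reApplyInnerSelf_eq_re_inner_right (V : H →L[𝕜] H) (x : H) :
    V.reApplyInnerSelf x = RCLike.re (inner 𝕜 x (V x)) := by
  rw [reApplyInnerSelf_apply, inner_re_symm]

theorem reApplyInnerSelf_mono {V U : H →L[𝕜] H} (h : V ≤ U) (x : H) :
    V.reApplyInnerSelf x ≤ U.reApplyInnerSelf x := by
  rw [← sub_nonneg, ← reApplyInnerSelf_sub]
  exact ((le_def V U).1 h).re_inner_nonneg_left x

section Order

variable [CompleteSpace H]

theorem nonneg_iff_reApplyInnerSelf (V : H →L[𝕜] H) :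
    0 ≤ V ↔ IsSelfAdjoint V ∧ ∀ x, 0 ≤ V.reApplyInnerSelf x := by
  rw [nonneg_iff_isPositive, isPositive_def']

theorem reApplyInnerSelf_nonneg {V : H →L[𝕜] H} (hV : 0 ≤ V) (x : H) :
    0 ≤ V.reApplyInnerSelf x :=
  ((nonneg_iff_reApplyInnerSelf V).1 hV).2 x

theorem le_of_reApplyInnerSelf_le {V U : H →L[𝕜] H} (hV : IsSelfAdjoint V)
    (hU : IsSelfAdjoint U) (h : ∀ x, V.reApplyInnerSelf x ≤ U.reApplyInnerSelf x) : V ≤ U := by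
  refine (le_def V U).2 (isPositive_def'.2 ⟨hU.sub hV, fun x => ?_⟩)
  rw [reApplyInnerSelf_sub]
  exact sub_nonneg.2 (h x)

theorem reApplyInnerSelf_conj {G : Type*} [NormedAddCommGroup G] [InnerProductSpace 𝕜 G]
    [CompleteSpace G] (S : H →L[𝕜] G) (V : H →L[𝕜] H) (y : G) :
    (S ∘L V ∘L adjoint S).reApplyInnerSelf y = V.reApplyInnerSelf (adjoint S y) := by
  rw [reApplyInnerSelf_apply, reApplyInnerSelf_apply, comp_apply, comp_apply, adjoint_inner_right]

theorem adjoint_mul_apply (A B : H →L[𝕜] H) (x : H) :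
    adjoint (A * B) x = adjoint B (adjoint A x) :=
  congrArg (fun C : H →L[𝕜] H => C x) (adjoint_comp A B)

end Order

end Forms

section LpTwo

variable {ι E : Type*} [NormedAddCommGroup E]

theorem lp_two_hasSum_norm_sq (x : lp (fun _ : ι => E) 2) :
    HasSum (fun β => ‖x β‖ ^ 2) (‖x‖ ^ 2) := by
  simpa using lp.hasSum_norm (p := 2) (by norm_num) x

theorem exists_lp_two_of_sum_norm_sq_le {𝕜 H : Type*} [NontriviallyNormedField 𝕜]
    [SeminormedAddCommGroup H] [NormedSpace 𝕜 H] [NormedSpace 𝕜 E] (L : ι → H →L[𝕜] E) {C : ℝ}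
    (hC : 0 ≤ C) (hL : ∀ x (F : Finset ι), ∑ β ∈ F, ‖L β x‖ ^ 2 ≤ (C * ‖x‖) ^ 2) :
    ∃ K : H →L[𝕜] lp (fun _ : ι => E) 2, (∀ x β, K x β = L β x) ∧ ∀ x, ‖K x‖ ≤ C * ‖x‖ := by
  have hmem : ∀ x, Memℓp (fun β => L β x) 2 := fun x =>
    memℓp_gen' (C := (C * ‖x‖) ^ 2) fun s => by simpa using hL x s
  have hb : ∀ x, ‖(⟨fun β => L β x, hmem x⟩ : lp (fun _ : ι => E) 2)‖ ≤ C * ‖x‖ := fun x =>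
    lp.norm_le_of_forall_sum_le (by norm_num) (by positivity) fun s => by simpa using hL x s
  exact ⟨LinearMap.mkContinuous
    { toFun := fun x => ⟨fun β => L β x, hmem x⟩
      map_add' := fun x y => by ext β; exact map_add _ _ _
      map_smul' := fun c x => by ext β; exact map_smul _ _ _ } C hb, fun x β => rfl, hb⟩

end LpTwo

/-! ### Positive maps with bounded orbits -/

section OrderedModule

variable {A : Type*} [AddCommGroup A] [PartialOrder A] [Module ℝ A] [PosSMulMono ℝ A]
  [TopologicalSpace A] [ContinuousSMul ℝ A] [OrderClosedTopology A]

theorem nonneg_of_forall_le_nsmul {C D : A} (h : ∀ N : ℕ, C ≤ N • D) : 0 ≤ D := by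
  have hlim : Tendsto (fun N : ℕ => (1 / ((N : ℝ) + 1)) • C) atTop (nhds 0) := by
    simpa using (tendsto_one_div_add_atTop_nhds_zero_nat (𝕜 := ℝ)).smul_const C
  refine le_of_tendsto' hlim fun N => ?_
  have hN : (0 : ℝ) < N + 1 := by positivity
  calc
    (1 / ((N : ℝ) + 1)) • C ≤ (1 / ((N : ℝ) + 1)) • ((N + 1) • D) :=
      smul_le_smul_of_nonneg_left (h (N + 1)) (by positivity)
    _ = D := by
      rw [← Nat.cast_smul_eq_nsmul ℝ, smul_smul, Nat.cast_succ, one_div_mul_cancel hN.ne',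
        one_smul]

/-- If `D = Z - ΦZ` satisfies `ΦD ≤ D`, then `Z - Φ^N Z = ∑_{q < N} Φ^q D ≤ N D`; the left-hand side
is bounded below independently of `N`. -/
theorem sub_map_nonneg_of_bounded_orbit [IsOrderedAddMonoid A] {Φ : A →+ A} (hΦ : Monotone Φ)
    {Z C : A} (hlow : -C ≤ Z) (hup : ∀ q, Φ^[q] Z ≤ C) (hD : Φ (Z - Φ Z) ≤ Z - Φ Z) :
    0 ≤ Z - Φ Z := by
  have hiter : ∀ q, Φ^[q] (Z - Φ Z) ≤ Z - Φ Z := fun q => by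
    induction q with
    | zero => exact le_rfl
    | succ q ih => rw [Function.iterate_succ_apply']; exact (hΦ ih).trans hD
  have hsum : ∀ N, ∑ q ∈ Finset.range N, Φ^[q] (Z - Φ Z) = Z - Φ^[N] Z := fun N => by
    simp only [iterate_map_sub, ← Function.iterate_succ_apply]
    exact Finset.sum_range_sub' (fun q => Φ^[q] Z) N
  refine nonneg_of_forall_le_nsmul (C := -C - C) fun N => ?_
  calc
    -C - C ≤ Z - Φ^[N] Z := sub_le_sub hlow (hup N)
    _ = ∑ q ∈ Finset.range N, Φ^[q] (Z - Φ Z) := (hsum N).symm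
    _ ≤ ∑ _q ∈ Finset.range N, (Z - Φ Z) := Finset.sum_le_sum fun q _ => hiter q
    _ = N • (Z - Φ Z) := by rw [Finset.sum_const, Finset.card_range]

end OrderedModule

/-! ### The maps `Φ_{f,X}` for row contractions -/

section Phi

variable {H : Type u} [NormedAddCommGroup H] [InnerProductSpace ℂ H] {n : ℕ}

theorem wordOp_cons (X : Fin n → H →L[ℂ] H) (j : Fin n) (α : List (Fin n)) :
    wordOp X (j :: α) = X j * wordOp X α :=
  List.prod_cons

theorem wordOp_append (X : Fin n → H →L[ℂ] H) (α γ : List (Fin n)) :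
    wordOp X (α ++ γ) = wordOp X α * wordOp X γ := by
  rw [wordOp, List.map_append, List.prod_append, wordOp, wordOp]

variable [CompleteSpace H]

theorem adjoint_wordOp_nil (X : Fin n → H →L[ℂ] H) : adjoint (wordOp X []) = 1 :=
  star_one (H →L[ℂ] H)

theorem adjoint_wordOp_cons_apply (X : Fin n → H →L[ℂ] H) (j : Fin n) (α : List (Fin n)) (x : H) :
    adjoint (wordOp X (j :: α)) x = adjoint (wordOp X α) (adjoint (X j) x) := by
  rw [wordOp_cons, adjoint_mul_apply]

theorem adjoint_wordOp_append_apply (X : Fin n → H →L[ℂ] H) (α γ : List (Fin n)) (x : H) :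
    adjoint (wordOp X (α ++ γ)) x = adjoint (wordOp X γ) (adjoint (wordOp X α) x) := by
  rw [wordOp_append, adjoint_mul_apply]

/-- The condition `∑_α a_α X_α X_α^* ≤ I`, in terms of finite partial sums. It is equivalent to the
existence of `Φ_{f,X}(I)` together with `Φ_{f,X}(I) ≤ I`. -/
def IsRowContraction (f : PosRegular n) (X : Fin n → H →L[ℂ] H) : Prop :=
  ∀ (x : H) (F : Finset (List (Fin n))),
    ∑ α ∈ F, f.coeff α * ‖adjoint (wordOp X α) x‖ ^ 2 ≤ ‖x‖ ^ 2

variable {f : PosRegular n} {X : Fin n → H →L[ℂ] H}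

theorem inner_phiTerm (V : H →L[ℂ] H) (α : List (Fin n)) (x y : H) :
    inner ℂ y (phiTerm f X V α x)
      = (f.coeff α : ℂ) * inner ℂ (adjoint (wordOp X α) y) (V (adjoint (wordOp X α) x)) := by
  rw [adjoint_inner_left, ← inner_smul_right]
  rfl

theorem hasSum_phiTerm_iff (V Z : H →L[ℂ] H) :
    HasSum (phiTerm f X V) (ContinuousLinearMapWOT.ofCLM Z) ↔
      ∀ x y, HasSum (fun α => (f.coeff α : ℂ) *
        inner ℂ (adjoint (wordOp X α) y) (V (adjoint (wordOp X α) x))) (inner ℂ y (Z x)) := by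
  have hsum : ∀ x y (F : Finset (List (Fin n))), inner ℂ y ((∑ α ∈ F, phiTerm f X V α) x)
      = ∑ α ∈ F, (f.coeff α : ℂ) *
        inner ℂ (adjoint (wordOp X α) y) (V (adjoint (wordOp X α) x)) := fun x y F => by
    induction F using Finset.cons_induction with
    | empty => simp
    | cons a s ha ih =>
      rw [Finset.sum_cons, Finset.sum_cons, ContinuousLinearMapWOT.add_apply, inner_add_right, ih,
        inner_phiTerm]
  simp only [HasSum, ContinuousLinearMapWOT.tendsto_iff_forall_inner_apply_tendsto, hsum]
  rfl

theorem reApplyInnerSelf_hasSum_of_hasSum_inner {V Z : H →L[ℂ] H} {x : H}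
    (h : HasSum (fun α => (f.coeff α : ℂ) *
      inner ℂ (adjoint (wordOp X α) x) (V (adjoint (wordOp X α) x))) (inner ℂ x (Z x))) :
    HasSum (fun α => f.coeff α * V.reApplyInnerSelf (adjoint (wordOp X α) x))
      (Z.reApplyInnerSelf x) := by
  rw [reApplyInnerSelf_eq_re_inner_right]
  refine (Complex.hasSum_re h).congr_fun fun α => ?_
  rw [reApplyInnerSelf_eq_re_inner_right, Complex.re_ofReal_mul]
  rfl

theorem isRowContraction_of_summable (hs : Summable (phiTerm f X 1)) (hle : phi f X 1 ≤ 1) :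
    IsRowContraction f X := by
  intro x F
  have h := reApplyInnerSelf_hasSum_of_hasSum_inner
    ((hasSum_phiTerm_iff 1 (phi f X 1)).1 hs.hasSum x x)
  simp only [reApplyInnerSelf_one] at h
  calc
    _ ≤ (phi f X 1).reApplyInnerSelf x :=
      sum_le_hasSum F (fun α _ => mul_nonneg (f.coeff_nonneg α) (by positivity)) h
    _ ≤ (1 : H →L[ℂ] H).reApplyInnerSelf x := reApplyInnerSelf_mono hle x
    _ = ‖x‖ ^ 2 := reApplyInnerSelf_one x

namespace IsRowContraction

theorem sum_norm_sq_comp_le (h : IsRowContraction f X) (U : H →L[ℂ] H) (x : H)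
    (F : Finset (List (Fin n))) :
    ∑ α ∈ F, ‖((√(f.coeff α) : ℝ) : ℂ) • U (adjoint (wordOp X α) x)‖ ^ 2 ≤ (‖U‖ * ‖x‖) ^ 2 := by
  rw [mul_pow]
  refine le_trans ?_ (mul_le_mul_of_nonneg_left (h x F) (sq_nonneg ‖U‖))
  rw [Finset.mul_sum]
  refine Finset.sum_le_sum fun α _ => ?_
  have hα := f.coeff_nonneg α
  rw [norm_smul, mul_pow, Complex.norm_real, Real.norm_of_nonneg (Real.sqrt_nonneg _),
    Real.sq_sqrt hα, mul_left_comm, ← mul_pow]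
  gcongr
  exact U.le_opNorm _

/-- `Φ_{f,X}(V) = C^* D` for the operators `C = (√a_α X_α^*)_α` and `D = (√a_α V X_α^*)_α` into
`ℓ²`. -/
theorem hasSum_phiTerm (h : IsRowContraction f X) (V : H →L[ℂ] H) :
    HasSum (phiTerm f X V) (ContinuousLinearMapWOT.ofCLM (phi f X V)) := by
  have hlift : ∀ U : H →L[ℂ] H, ∃ K : H →L[ℂ] lp (fun _ : List (Fin n) => H) 2,
      ∀ x α, K x α = ((√(f.coeff α) : ℝ) : ℂ) • U (adjoint (wordOp X α) x) := fun U => by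
    obtain ⟨K, hK, -⟩ := exists_lp_two_of_sum_norm_sq_le
      (fun α => ((√(f.coeff α) : ℝ) : ℂ) • (U ∘L adjoint (wordOp X α))) (norm_nonneg U)
      (h.sum_norm_sq_comp_le U)
    exact ⟨K, hK⟩
  obtain ⟨C, hC⟩ := hlift 1
  obtain ⟨D, hD⟩ := hlift V
  have hs : HasSum (phiTerm f X V) (ContinuousLinearMapWOT.ofCLM (adjoint C ∘L D)) := by
    refine (hasSum_phiTerm_iff V _).2 fun x y => ?_
    rw [comp_apply, adjoint_inner_right]
    refine (lp.hasSum_inner (𝕜 := ℂ) (C y) (D x)).congr_fun fun α => ?_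
    rw [hC, hD, inner_smul_left, inner_smul_right, Complex.conj_ofReal, ← mul_assoc,
      ← Complex.ofReal_mul, Real.mul_self_sqrt (f.coeff_nonneg α), one_apply_eq_self]
  rw [phi, hs.tsum_eq]
  exact hs

theorem hasSum_inner_phi (h : IsRowContraction f X) (V : H →L[ℂ] H) (x y : H) :
    HasSum (fun α => (f.coeff α : ℂ) *
      inner ℂ (adjoint (wordOp X α) y) (V (adjoint (wordOp X α) x))) (inner ℂ y (phi f X V x)) :=
  (hasSum_phiTerm_iff V _).1 (h.hasSum_phiTerm V) x y

theorem hasSum_reApplyInnerSelf_phi (h : IsRowContraction f X) (V : H →L[ℂ] H) (x : H) :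
    HasSum (fun α => f.coeff α * V.reApplyInnerSelf (adjoint (wordOp X α) x))
      ((phi f X V).reApplyInnerSelf x) :=
  reApplyInnerSelf_hasSum_of_hasSum_inner (h.hasSum_inner_phi V x x)

theorem phi_isSelfAdjoint (h : IsRowContraction f X) {V : H →L[ℂ] H} (hV : IsSelfAdjoint V) :
    IsSelfAdjoint (phi f X V) := by
  rw [isSelfAdjoint_iff']
  refine ContinuousLinearMap.ext fun x => ext_inner_left ℂ fun y => ?_
  have hconj := Complex.hasSum_conj'.2 (h.hasSum_inner_phi V y x)
  rw [inner_conj_symm] at hconj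
  rw [adjoint_inner_right]
  refine hconj.unique ((h.hasSum_inner_phi V x y).congr_fun fun α => ?_)
  rw [map_mul, Complex.conj_ofReal, inner_conj_symm, ← adjoint_inner_right, hV.adjoint_eq]

/-- `Φ_{f,X}` as a linear map. -/
noncomputable def phiLinearMap (h : IsRowContraction f X) : (H →L[ℂ] H) →ₗ[ℂ] (H →L[ℂ] H) where
  toFun := phi f X
  map_add' V U := ContinuousLinearMap.ext fun x => ext_inner_left ℂ fun y => by
    rw [add_apply, inner_add_right]
    refine (h.hasSum_inner_phi (V + U) x y).unique
      (((h.hasSum_inner_phi V x y).add (h.hasSum_inner_phi U x y)).congr_fun fun α => ?_)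
    rw [add_apply, inner_add_right, mul_add]
  map_smul' c V := ContinuousLinearMap.ext fun x => ext_inner_left ℂ fun y => by
    rw [smul_apply, inner_smul_right]
    refine (h.hasSum_inner_phi (c • V) x y).unique
      (((h.hasSum_inner_phi V x y).mul_left c).congr_fun fun α => ?_)
    rw [smul_apply, inner_smul_right, mul_left_comm]

theorem phi_mono (h : IsRowContraction f X) : Monotone (phi f X) := fun V U hVU => by
  have hsub : phi f X (U - V) = phi f X U - phi f X V := map_sub h.phiLinearMap U V
  rw [← sub_nonneg, nonneg_iff_reApplyInnerSelf] at hVU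
  rw [← sub_nonneg, ← hsub, nonneg_iff_reApplyInnerSelf]
  exact ⟨h.phi_isSelfAdjoint hVU.1, fun x => (h.hasSum_reApplyInnerSelf_phi _ x).nonneg fun α =>
    mul_nonneg (f.coeff_nonneg α) (hVU.2 _)⟩

theorem phi_one_le (h : IsRowContraction f X) : phi f X 1 ≤ 1 :=
  le_of_reApplyInnerSelf_le (h.phi_isSelfAdjoint (IsSelfAdjoint.one _)) (IsSelfAdjoint.one _)
    fun x => by
      simp only [reApplyInnerSelf_one]
      refine hasSum_le_of_sum_le (h.hasSum_reApplyInnerSelf_phi 1 x) fun F => ?_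
      simpa only [reApplyInnerSelf_one] using h x F

theorem phi_smul_one_le (h : IsRowContraction f X) {c : ℝ} (hc : 0 ≤ c) :
    phi f X (c • 1) ≤ c • 1 := by
  have hsmul : phi f X (c • 1) = c • phi f X 1 := h.phiLinearMap.map_smul_of_tower c 1
  rw [hsmul]
  exact smul_le_smul_of_nonneg_left h.phi_one_le hc

theorem sub_phi_nonneg (h : IsRowContraction f X) {Z : H →L[ℂ] H} (hZ : IsSelfAdjoint Z)
    (hD : 0 ≤ (Z - phi f X Z) - phi f X (Z - phi f X Z)) : 0 ≤ Z - phi f X Z := by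
  refine sub_map_nonneg_of_bounded_orbit (Φ := h.phiLinearMap.toAddMonoidHom) (C := ‖Z‖ • 1)
    h.phi_mono ?_ (fun q => ?_) (sub_nonneg.1 hD)
  · simpa only [Algebra.algebraMap_eq_smul_one] using hZ.neg_algebraMap_norm_le_self
  · induction q with
    | zero =>
      simpa only [Algebra.algebraMap_eq_smul_one, Function.iterate_zero_apply]
        using hZ.le_algebraMap_norm_self
    | succ q ih =>
      rw [Function.iterate_succ_apply']
      exact (h.phi_mono ih).trans (h.phi_smul_one_le (norm_nonneg Z))

theorem iterate_isSelfAdjoint (h : IsRowContraction f X) {Z : H →L[ℂ] H} (hZ : IsSelfAdjoint Z)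
    (p : ℕ) : IsSelfAdjoint ((fun V => V - phi f X V)^[p] Z) := by
  induction p with
  | zero => exact hZ
  | succ p ih =>
    rw [Function.iterate_succ_apply']
    exact ih.sub (h.phi_isSelfAdjoint ih)

theorem iterate_nonneg (h : IsRowContraction f X) {Z : H →L[ℂ] H} (hZ : 0 ≤ Z) {m : ℕ}
    (hm : 0 ≤ (fun V => V - phi f X V)^[m] Z) {p : ℕ} (hp : p ≤ m) :
    0 ≤ (fun V => V - phi f X V)^[p] Z := by
  induction hp using Nat.decreasingInduction with
  | self => exact hm
  | of_succ q hq ih =>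
    rcases q with _ | q
    · exact hZ
    · rw [Function.iterate_succ_apply', Function.iterate_succ_apply'] at ih
      rw [Function.iterate_succ_apply']
      exact h.sub_phi_nonneg (h.iterate_isSelfAdjoint (IsSelfAdjoint.of_nonneg hZ) q) ih

end IsRowContraction

end Phi

/-! ### Truncated sums over words -/

section WordSum

variable {H : Type u} [NormedAddCommGroup H] [InnerProductSpace ℂ H] [CompleteSpace H] {n : ℕ}

theorem sum_words_invCoeff_succ (f : PosRegular n) (m N : ℕ) (g : List (Fin n) → ℝ) :
    ∑ α ∈ words (Fin n) N, invCoeff f (m + 1) α *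
        (g α - ∑ γ ∈ words (Fin n) (N - α.length), f.coeff γ * g (α ++ γ))
      = ∑ α ∈ words (Fin n) N, invCoeff f m α * g α := by
  have hsplit := sum_words_splits N fun α γ => invCoeff f (m + 1) α * (f.coeff γ * g (α ++ γ))
  simp only [mul_sub, Finset.sum_sub_distrib, Finset.mul_sum]
  rw [← hsplit, ← Finset.sum_sub_distrib]
  refine Finset.sum_congr rfl fun β _ => ?_
  rw [invCoeff_succ_right, add_mul, Finset.sum_mul, add_sub_assoc, add_eq_left, sub_eq_zero]
  refine Finset.sum_congr rfl fun p hp => ?_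
  rw [mem_splits.1 hp, mul_assoc]

/-- The truncation to words of length at most `N` of the sum `∑_α b_α^{(m)} g(X_α^* y)`. -/
noncomputable def wordSum (f : PosRegular n) (m : ℕ) (X : Fin n → H →L[ℂ] H) (N : ℕ) (g : H → ℝ)
    (y : H) : ℝ :=
  ∑ α ∈ words (Fin n) N, invCoeff f m α * g (adjoint (wordOp X α) y)

theorem wordSum_zero (f : PosRegular n) (X : Fin n → H →L[ℂ] H) (N : ℕ) (g : H → ℝ) (y : H) :
    wordSum f 0 X N g y = g y := by
  rw [wordSum, Finset.sum_eq_single_of_mem [] (mem_words.2 (Nat.zero_le _)), invCoeff_nil, one_mul,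
    adjoint_wordOp_nil, one_apply_eq_self]
  intro α _ hα
  rw [invCoeff_zero, NCSeries.one_apply_of_ne_nil hα, zero_mul]

variable {f : PosRegular n} {X : Fin n → H →L[ℂ] H}

theorem IsRowContraction.wordSum_iterate_le (h : IsRowContraction f X) (N : ℕ) {V : H →L[ℂ] H}
    {m : ℕ} (hV : ∀ p < m, 0 ≤ (fun V => V - phi f X V)^[p] V) (y : H) :
    wordSum f m X N ((fun V => V - phi f X V)^[m] V).reApplyInnerSelf y
      ≤ V.reApplyInnerSelf y := by
  induction m with
  | zero => rw [wordSum_zero, Function.iterate_zero_apply]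
  | succ m ih =>
    refine le_trans ?_ (ih fun p hp => hV p (hp.trans m.lt_succ_self))
    have hU := hV m m.lt_succ_self
    rw [Function.iterate_succ_apply']
    set U := (fun V => V - phi f X V)^[m] V
    rw [wordSum, wordSum,
      ← sum_words_invCoeff_succ f m N fun α => U.reApplyInnerSelf (adjoint (wordOp X α) y)]
    refine Finset.sum_le_sum fun α _ => mul_le_mul_of_nonneg_left ?_ (invCoeff_nonneg _ _ _)
    rw [reApplyInnerSelf_sub]
    refine sub_le_sub_left ?_ _
    simp only [adjoint_wordOp_append_apply]
    exact sum_le_hasSum _ (fun γ _ => mul_nonneg (f.coeff_nonneg γ) (reApplyInnerSelf_nonneg hU _))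
      (h.hasSum_reApplyInnerSelf_phi U _)

theorem IsRowContraction.wordSum_iterate_eq (h : IsRowContraction f X) {N : ℕ} (V : H →L[ℂ] H)
    (m : ℕ) {y : H} (hy : ∀ α : List (Fin n), N < α.length → adjoint (wordOp X α) y = 0) :
    wordSum f m X N ((fun V => V - phi f X V)^[m] V).reApplyInnerSelf y
      = V.reApplyInnerSelf y := by
  induction m with
  | zero => rw [wordSum_zero, Function.iterate_zero_apply]
  | succ m ih =>
    refine Eq.trans ?_ ih
    rw [Function.iterate_succ_apply']
    set U := (fun V => V - phi f X V)^[m] V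
    rw [wordSum, wordSum,
      ← sum_words_invCoeff_succ f m N fun α => U.reApplyInnerSelf (adjoint (wordOp X α) y)]
    refine Finset.sum_congr rfl fun α hα => ?_
    rw [reApplyInnerSelf_sub]
    congr 2
    simp only [adjoint_wordOp_append_apply]
    refine (h.hasSum_reApplyInnerSelf_phi U _).unique
      (hasSum_sum_of_ne_finset_zero fun γ hγ => ?_)
    have hlong : N < (α ++ γ).length := by
      rw [mem_words] at hα hγ
      rw [List.length_append]
      omega
    rw [← adjoint_wordOp_append_apply, hy _ hlong, reApplyInnerSelf_zero_right, mul_zero]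

end WordSum

section Box

variable {k : ℕ} {n : Fin k → ℕ}

/-- The tuples of words of length at most `N` whose components outside `l` are empty. -/
noncomputable def box (n : Fin k → ℕ) (N : ℕ) (l : List (Fin k)) :
    Finset (∀ i, List (Fin (n i))) :=
  Fintype.piFinset fun i => if i ∈ l then words (Fin (n i)) N else {[]}

theorem mem_box {N : ℕ} {l : List (Fin k)} {β : ∀ i, List (Fin (n i))} :
    β ∈ box n N l ↔ ∀ i, (i ∈ l → (β i).length ≤ N) ∧ (i ∉ l → β i = []) := by
  rw [box, Fintype.mem_piFinset]
  refine forall_congr' fun i => ?_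
  by_cases hi : i ∈ l <;> simp [hi, mem_words]

theorem exists_subset_box (F : Finset (∀ i, List (Fin (n i)))) :
    ∃ N, F ⊆ box n N (List.finRange k) := by
  refine ⟨F.sup fun β => Finset.univ.sup fun i => (β i).length, fun β hβ => ?_⟩
  refine mem_box.2 fun i => ⟨fun _ => ?_, fun hi => absurd (List.mem_finRange i) hi⟩
  calc
    (β i).length ≤ Finset.univ.sup fun i => (β i).length :=
      Finset.le_sup (f := fun i => (β i).length) (Finset.mem_univ i)
    _ ≤ _ := Finset.le_sup (f := fun β : ∀ i, List (Fin (n i)) =>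
      Finset.univ.sup fun i => (β i).length) hβ

theorem sum_box_nil {M : Type*} [AddCommMonoid M] (N : ℕ) (F : (∀ i, List (Fin (n i))) → M) :
    ∑ β ∈ box n N [], F β = F fun _ => [] := by
  have hbox : box n N [] = {fun _ => []} := by
    ext β
    simp [mem_box, funext_iff]
  rw [hbox, Finset.sum_singleton]

theorem sum_box_cons {M : Type*} [AddCommMonoid M] (N : ℕ) {i : Fin k} {l : List (Fin k)}
    (hi : i ∉ l) (F : (∀ i, List (Fin (n i))) → M) :
    ∑ β ∈ box n N (i :: l), F β
      = ∑ β ∈ box n N l, ∑ α ∈ words (Fin (n i)) N, F (Function.update β i α) := by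
  rw [Finset.sum_sigma']
  refine Finset.sum_bij' (fun β _ => ⟨Function.update β i [], β i⟩)
    (fun x _ => Function.update x.1 i x.2) (fun β hβ => ?_) (fun x hx => ?_) (fun β _ => by simp)
    (fun x hx => ?_) (fun β _ => by simp)
  · rw [mem_box] at hβ
    refine Finset.mem_sigma.2 ⟨mem_box.2 fun i' => ?_, mem_words.2 ((hβ i).1 List.mem_cons_self)⟩
    rcases eq_or_ne i' i with rfl | hi'
    · simp [hi]
    · simpa [Function.update_of_ne hi', hi'] using hβ i'
  · rw [Finset.mem_sigma, mem_box, mem_words] at hx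
    refine mem_box.2 fun i' => ?_
    rcases eq_or_ne i' i with rfl | hi'
    · simpa using hx.2
    · simpa [Function.update_of_ne hi', hi'] using hx.1 i'
  · rw [Finset.mem_sigma, mem_box] at hx
    have hnil : x.1 i = [] := (hx.1 i).2 hi
    simp [← hnil]

end Box

section BoxSum

variable {k : ℕ} {n : Fin k → ℕ} {H : Type u} [NormedAddCommGroup H] [InnerProductSpace ℂ H]
  [CompleteSpace H]

/-- The product of the operators `X_{i,β_i}^*` over the indices `i` in the list `l`. -/
noncomputable def adjointWordProd (X : ∀ i, Fin (n i) → H →L[ℂ] H) (l : List (Fin k))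
    (β : ∀ i, List (Fin (n i))) : H →L[ℂ] H :=
  (l.map fun i => adjoint (wordOp (X i) (β i))).prod

theorem adjointWordProd_cons (X : ∀ i, Fin (n i) → H →L[ℂ] H) (i : Fin k) (l : List (Fin k))
    (β : ∀ i, List (Fin (n i))) :
    adjointWordProd X (i :: l) β = adjoint (wordOp (X i) (β i)) * adjointWordProd X l β :=
  rfl

theorem adjointWordProd_congr (X : ∀ i, Fin (n i) → H →L[ℂ] H) {l : List (Fin k)}
    {β γ : ∀ i, List (Fin (n i))} (h : ∀ i ∈ l, β i = γ i) :
    adjointWordProd X l β = adjointWordProd X l γ :=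
  congrArg List.prod (List.map_congr_left fun i hi => by rw [h i hi])

/-- The sum of `∏_i b_{i,β_i}^{(m_i)} g(∏_i X_{i,β_i}^* y)` over the tuples of words of length at
most `N`, both products being restricted to the indices `i` in the list `l`. -/
noncomputable def boxSum (f : ∀ i, PosRegular (n i)) (m : Fin k → ℕ)
    (X : ∀ i, Fin (n i) → H →L[ℂ] H) (N : ℕ) (l : List (Fin k)) (g : H → ℝ) (y : H) : ℝ :=
  ∑ β ∈ box n N l, (l.map fun i => invCoeff (f i) (m i) (β i)).prod * g (adjointWordProd X l β y)

variable (f : ∀ i, PosRegular (n i)) (m : Fin k → ℕ) {X : ∀ i, Fin (n i) → H →L[ℂ] H} (N : ℕ)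

theorem boxSum_nil (g : H → ℝ) (y : H) : boxSum f m X N [] g y = g y := by
  rw [boxSum, sum_box_nil, List.map_nil, List.prod_nil, one_mul]
  rfl

theorem boxSum_cons {i : Fin k} {l : List (Fin k)} (hi : i ∉ l) (g : H → ℝ) (y : H) :
    boxSum f m X N (i :: l) g y = boxSum f m X N l (wordSum (f i) (m i) (X i) N g) y := by
  rw [boxSum, boxSum, sum_box_cons N hi]
  refine Finset.sum_congr rfl fun β _ => ?_
  rw [wordSum, Finset.mul_sum]
  refine Finset.sum_congr rfl fun α _ => ?_
  have hupdate : ∀ i' ∈ l, Function.update β i α i' = β i' := fun i' hi' =>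
    Function.update_of_ne (ne_of_mem_of_not_mem hi' hi) _ _
  have hcoeff : (l.map fun i' => invCoeff (f i') (m i') (Function.update β i α i'))
      = l.map fun i' => invCoeff (f i') (m i') (β i') :=
    List.map_congr_left fun i' hi' => by rw [hupdate i' hi']
  have hword : adjointWordProd X l (Function.update β i α) = adjointWordProd X l β :=
    adjointWordProd_congr X hupdate
  rw [List.map_cons, List.prod_cons, hcoeff, Function.update_self, mul_comm (invCoeff _ _ _),
    mul_assoc, ← hword]
  congr 3
  exact congrArg (fun δ => adjoint (wordOp (X i) δ) _) (Function.update_self i α β)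

theorem boxSum_mono {l : List (Fin k)} {g g' : H → ℝ} (h : g ≤ g') (y : H) :
    boxSum f m X N l g y ≤ boxSum f m X N l g' y := by
  refine Finset.sum_le_sum fun β _ => mul_le_mul_of_nonneg_left (h _) (List.prod_nonneg ?_)
  rintro _ ha
  obtain ⟨i, -, rfl⟩ := List.mem_map.1 ha
  exact invCoeff_nonneg _ _ _

theorem adjointWordProd_mem {P : Set H}
    (hP : ∀ y ∈ P, ∀ i α, adjoint (wordOp (X i) α) y ∈ P) (l : List (Fin k))
    (β : ∀ i, List (Fin (n i))) {y : H} (hy : y ∈ P) : adjointWordProd X l β y ∈ P := by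
  induction l with
  | nil => exact hy
  | cons i l ih => exact hP _ ih i (β i)

theorem boxSum_congr {P : Set H} (hP : ∀ y ∈ P, ∀ i α, adjoint (wordOp (X i) α) y ∈ P)
    {l : List (Fin k)} {g g' : H → ℝ} (h : Set.EqOn g g' P) {y : H} (hy : y ∈ P) :
    boxSum f m X N l g y = boxSum f m X N l g' y :=
  Finset.sum_congr rfl fun β _ => by rw [h (adjointWordProd_mem hP l β hy)]

end BoxSum

/-! ### Defect maps of several row contractions -/

section DefectFold

variable {k : ℕ} {n : Fin k → ℕ} {H : Type u} [NormedAddCommGroup H] [InnerProductSpace ℂ H]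
  [CompleteSpace H]

/-- The composition of the maps `(id - Φ_i)^{p_i}` over the indices `i` in a list. It is
`defectMap f X p` for the list of all indices. -/
noncomputable def defectFold (f : ∀ i, PosRegular (n i)) (X : ∀ i, Fin (n i) → H →L[ℂ] H)
    (p : Fin k → ℕ) (l : List (Fin k)) (Y : H →L[ℂ] H) : H →L[ℂ] H :=
  l.foldr (fun i Z => (fun V => V - phi (f i) (X i) V)^[p i] Z) Y

variable (f : ∀ i, PosRegular (n i)) (X : ∀ i, Fin (n i) → H →L[ℂ] H)

theorem defectFold_cons (p : Fin k → ℕ) (i : Fin k) (l : List (Fin k)) (Y : H →L[ℂ] H) :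
    defectFold f X p (i :: l) Y
      = (fun V => V - phi (f i) (X i) V)^[p i] (defectFold f X p l Y) :=
  rfl

theorem defectFold_append (p : Fin k → ℕ) (l l' : List (Fin k)) (Y : H →L[ℂ] H) :
    defectFold f X p (l ++ l') Y = defectFold f X p l (defectFold f X p l' Y) :=
  List.foldr_append

theorem defectFold_congr {p q : Fin k → ℕ} {l : List (Fin k)} (h : ∀ i ∈ l, p i = q i)
    (Y : H →L[ℂ] H) : defectFold f X p l Y = defectFold f X q l Y := by
  induction l with
  | nil => rfl
  | cons i l ih =>
    rw [List.forall_mem_cons] at h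
    rw [defectFold_cons, defectFold_cons, h.1, ih h.2]

theorem defectFold_zero (l : List (Fin k)) (Y : H →L[ℂ] H) :
    defectFold f X (fun _ => 0) l Y = Y := by
  induction l with
  | nil => rfl
  | cons i l ih => rw [defectFold_cons, ih, Function.iterate_zero_apply]

theorem defectFold_eq_defectMap_of_suffix (p : Fin k → ℕ) {l : List (Fin k)}
    (hl : l <:+ List.finRange k) (Y : H →L[ℂ] H) :
    defectFold f X p l Y = defectMap f X (fun i => if i ∈ l then p i else 0) Y := by
  obtain ⟨s, hs⟩ := hl
  have hdisj : s.Disjoint l := List.disjoint_of_nodup_append (hs ▸ List.nodup_finRange k)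
  change _ = defectFold f X _ (List.finRange k) Y
  rw [← hs, defectFold_append, defectFold_congr f X (q := fun _ => 0) (l := s)
    fun i hi => if_neg (hdisj hi), defectFold_zero]
  exact defectFold_congr f X (fun i hi => (if_pos hi).symm) Y

variable {f X}

theorem defectFold_isSelfAdjoint (hX : ∀ i, IsRowContraction (f i) (X i)) (p : Fin k → ℕ)
    (l : List (Fin k)) {V : H →L[ℂ] H} (hV : IsSelfAdjoint V) :
    IsSelfAdjoint (defectFold f X p l V) := by
  induction l with
  | nil => exact hV
  | cons i l ih => exact (hX i).iterate_isSelfAdjoint ih _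

theorem boxSum_defectFold_le (hX : ∀ i, IsRowContraction (f i) (X i)) {m : Fin k → ℕ} (N : ℕ)
    {l : List (Fin k)} (hl : l.Nodup) {V : H →L[ℂ] H}
    (hV : ∀ l', l' <:+ l → 0 ≤ defectFold f X m l' V) (y : H) :
    boxSum f m X N l (defectFold f X m l V).reApplyInnerSelf y ≤ V.reApplyInnerSelf y := by
  induction l with
  | nil => exact (boxSum_nil f m N _ y).le
  | cons i l ih =>
    rw [List.nodup_cons] at hl
    have hVl : ∀ l', l' <:+ l → 0 ≤ defectFold f X m l' V := fun l' hl' =>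
      hV l' (hl'.trans (List.suffix_cons i l))
    rw [boxSum_cons f m N hl.1]
    refine (boxSum_mono f m N (fun z => ?_) y).trans (ih hl.2 hVl)
    exact (hX i).wordSum_iterate_le N (fun p hp => (hX i).iterate_nonneg (hVl l List.suffix_rfl)
      (hV (i :: l) List.suffix_rfl) hp.le) z

theorem boxSum_defectFold_eq (hX : ∀ i, IsRowContraction (f i) (X i)) (m : Fin k → ℕ) {N : ℕ}
    {P : Set H} (hP : ∀ y ∈ P, ∀ i α, adjoint (wordOp (X i) α) y ∈ P)
    (hN : ∀ y ∈ P, ∀ i (α : List (Fin (n i))), N < α.length → adjoint (wordOp (X i) α) y = 0)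
    {l : List (Fin k)} (hl : l.Nodup) (V : H →L[ℂ] H) {y : H} (hy : y ∈ P) :
    boxSum f m X N l (defectFold f X m l V).reApplyInnerSelf y = V.reApplyInnerSelf y := by
  induction l with
  | nil => exact boxSum_nil f m N _ y
  | cons i l ih =>
    rw [List.nodup_cons] at hl
    rw [boxSum_cons f m N hl.1, ← ih hl.2]
    exact boxSum_congr f m N hP
      (fun z hz => (hX i).wordSum_iterate_eq (defectFold f X m l V) (m i) (hN z hz i)) hy

end DefectFold

section MemPolydomain

variable {k : ℕ} {n : Fin k → ℕ} {H : Type u} [NormedAddCommGroup H] [InnerProductSpace ℂ H]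
  [CompleteSpace H] {f : ∀ i, PosRegular (n i)} {m : Fin k → ℕ} {T : ∀ i, Fin (n i) → H →L[ℂ] H}

namespace MemPolydomain

theorem isRowContraction (hT : MemPolydomain f m T) (i : Fin k) :
    IsRowContraction (f i) (T i) :=
  isRowContraction_of_summable (hT.summable i) (hT.phi_le_one i)

theorem defectFold_nonneg (hT : MemPolydomain f m T) {l : List (Fin k)}
    (hl : l <:+ List.finRange k) : 0 ≤ defectFold f T m l 1 := by
  have hε : (fun i => ((if i ∈ l then 1 else 0 : Fin 2) : ℕ) * m i)
      = fun i => if i ∈ l then m i else 0 := by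
    funext i
    split_ifs <;> simp
  rw [defectFold_eq_defectMap_of_suffix f T m hl, ← hε]
  exact hT.defect_nonneg _

theorem defectMap_nonneg (hT : MemPolydomain f m T) : 0 ≤ defectMap f T m 1 :=
  hT.defectFold_nonneg List.suffix_rfl

end MemPolydomain

end MemPolydomain

/-! ### The Berezin kernel -/

section Kernel

variable {k : ℕ} {n : Fin k → ℕ} {H : Type u} [NormedAddCommGroup H] [InnerProductSpace ℂ H]
  [CompleteSpace H]

theorem adjoint_opSqrt (A : H →L[ℂ] H) : adjoint (opSqrt A) = opSqrt A :=
  (CFC.sqrt_nonneg A).isSelfAdjoint.adjoint_eq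

theorem opSqrt_opSqrt_apply {A : H →L[ℂ] H} (hA : 0 ≤ A) (x : H) :
    opSqrt A (opSqrt A x) = A x :=
  congrArg (fun B : H →L[ℂ] H => B x) (CFC.sqrt_mul_sqrt_self A hA)

theorem norm_sqrtInto_sq {A : H →L[ℂ] H} (hA : 0 ≤ A) (x : H) :
    ‖sqrtInto A x‖ ^ 2 = A.reApplyInnerSelf x := by
  rw [reApplyInnerSelf_apply, ← opSqrt_opSqrt_apply hA, ← adjoint_inner_right, adjoint_opSqrt,
    inner_self_eq_norm_sq]
  rfl

/-- The operator `h ↦ √b_β Δ_{f,T}^m(I)^{1/2} T_β^* h`, a coordinate of the Berezin kernel. -/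
noncomputable def kernelEntry (f : ∀ i, PosRegular (n i)) (m : Fin k → ℕ)
    (T : ∀ i, Fin (n i) → H →L[ℂ] H) (β : ∀ i, List (Fin (n i))) : H →L[ℂ] defectSpace f m T :=
  ((∏ i, √(bCoeff (f i) (m i) (β i)) : ℝ) : ℂ) •
    (sqrtInto (defectMap f T m 1) ∘L adjointWordProd T (List.finRange k) β)

variable {f : ∀ i, PosRegular (n i)} {m : Fin k → ℕ} {T : ∀ i, Fin (n i) → H →L[ℂ] H}

theorem isBerezinKernel_iff {K : H →L[ℂ] FockTensor n (defectSpace f m T)} :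
    IsBerezinKernel f m T K ↔ ∀ h β, K h β = kernelEntry f m T β h :=
  Iff.rfl

theorem norm_kernelEntry_sq (hm : ∀ i, 1 ≤ m i) (hT : 0 ≤ defectMap f T m 1)
    (β : ∀ i, List (Fin (n i))) (h : H) :
    ‖kernelEntry f m T β h‖ ^ 2
      = ((List.finRange k).map fun i => invCoeff (f i) (m i) (β i)).prod *
        (defectMap f T m 1).reApplyInnerSelf (adjointWordProd T (List.finRange k) β h) := by
  rw [kernelEntry, smul_apply, norm_smul, mul_pow, comp_apply, norm_sqrtInto_sq hT,
    Complex.norm_real, Real.norm_eq_abs, sq_abs, ← Finset.prod_pow, ← Fin.prod_univ_def]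
  congr 1
  refine Finset.prod_congr rfl fun i _ => ?_
  rw [Real.sq_sqrt (bCoeff_pos _ _ _).le, bCoeff_eq_invCoeff _ (hm i)]

theorem sum_box_norm_kernelEntry_sq (hm : ∀ i, 1 ≤ m i) (hT : 0 ≤ defectMap f T m 1) (N : ℕ)
    (h : H) :
    ∑ β ∈ box n N (List.finRange k), ‖kernelEntry f m T β h‖ ^ 2
      = boxSum f m T N (List.finRange k) (defectMap f T m 1).reApplyInnerSelf h :=
  Finset.sum_congr rfl fun β _ => norm_kernelEntry_sq hm hT β h

namespace MemPolydomain

theorem sum_norm_kernelEntry_sq_le (hT : MemPolydomain f m T) (hm : ∀ i, 1 ≤ m i) (h : H)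
    (F : Finset (∀ i, List (Fin (n i)))) :
    ∑ β ∈ F, ‖kernelEntry f m T β h‖ ^ 2 ≤ ‖h‖ ^ 2 := by
  obtain ⟨N, hN⟩ := exists_subset_box F
  calc
    _ ≤ ∑ β ∈ box n N (List.finRange k), ‖kernelEntry f m T β h‖ ^ 2 :=
      Finset.sum_le_sum_of_subset_of_nonneg hN fun β _ _ => sq_nonneg _
    _ = boxSum f m T N (List.finRange k) (defectMap f T m 1).reApplyInnerSelf h :=
      sum_box_norm_kernelEntry_sq hm hT.defectMap_nonneg N h
    _ ≤ (1 : H →L[ℂ] H).reApplyInnerSelf h :=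
      boxSum_defectFold_le hT.isRowContraction N (List.nodup_finRange k)
        (fun _ hl => hT.defectFold_nonneg hl) h
    _ = ‖h‖ ^ 2 := reApplyInnerSelf_one h

theorem isBerezinKernel_berezinKernel (hT : MemPolydomain f m T) (hm : ∀ i, 1 ≤ m i) :
    IsBerezinKernel f m T (berezinKernel f m T) := by
  have hex : ∃ K, IsBerezinKernel f m T K := by
    obtain ⟨K, hK, -⟩ := exists_lp_two_of_sum_norm_sq_le (kernelEntry f m T) zero_le_one
      fun h F => by simpa only [one_mul] using hT.sum_norm_kernelEntry_sq_le hm h F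
    exact ⟨K, hK⟩
  rw [berezinKernel, dif_pos hex]
  exact hex.choose_spec

theorem norm_berezinKernel_le (hT : MemPolydomain f m T) (hm : ∀ i, 1 ≤ m i) (h : H) :
    ‖berezinKernel f m T h‖ ≤ ‖h‖ := by
  refine lp.norm_le_of_forall_sum_le (by norm_num) (norm_nonneg h) fun F => ?_
  simp only [ENNReal.toReal_ofNat, Real.rpow_ofNat,
    isBerezinKernel_iff.1 (hT.isBerezinKernel_berezinKernel hm)]
  exact hT.sum_norm_kernelEntry_sq_le hm h F

end MemPolydomain

end Kernel

/-! ### The universal model -/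

section Diagonal

variable {ι : Type*} {E : Type u} [NormedAddCommGroup E] [InnerProductSpace ℂ E]

theorem inner_apply_eq_inner_single [DecidableEq ι] (β : ι) (y : E)
    (x : lp (fun _ : ι => E) 2) :
    inner ℂ y (x β) = inner ℂ (lp.single 2 β y : lp (fun _ : ι => E) 2) x := by
  rw [lp.inner_single_left]

/-- The operator `V` multiplies the coordinate `β` by the real number `d β`. -/
def IsDiagonal (V : lp (fun _ : ι => E) 2 →L[ℂ] lp (fun _ : ι => E) 2) (d : ι → ℝ) : Prop :=
  ∀ x β, V x β = (d β : ℂ) • x β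

namespace IsDiagonal

variable {V : lp (fun _ : ι => E) 2 →L[ℂ] lp (fun _ : ι => E) 2} {d : ι → ℝ}

theorem one : IsDiagonal (1 : lp (fun _ : ι => E) 2 →L[ℂ] lp (fun _ : ι => E) 2) fun _ => 1 :=
  fun x β => by rw [Complex.ofReal_one, one_smul, one_apply_eq_self]

theorem hasSum_reApplyInnerSelf (hV : IsDiagonal V d) (x : lp (fun _ : ι => E) 2) :
    HasSum (fun β => d β * ‖x β‖ ^ 2) (V.reApplyInnerSelf x) := by
  rw [reApplyInnerSelf_eq_re_inner_right]
  refine (Complex.hasSum_re (lp.hasSum_inner (𝕜 := ℂ) x (V x))).congr_fun fun β => ?_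
  rw [hV, inner_smul_right, Complex.re_ofReal_mul]
  exact congrArg (d β * ·) (inner_self_eq_norm_sq (𝕜 := ℂ) (x β)).symm

theorem nonneg [CompleteSpace E] (hV : IsDiagonal V d) (hd : ∀ β, 0 ≤ d β) : 0 ≤ V := by
  refine (nonneg_iff_reApplyInnerSelf V).2 ⟨?_, fun x => (hV.hasSum_reApplyInnerSelf x).nonneg
    fun β => mul_nonneg (hd β) (sq_nonneg _)⟩
  rw [isSelfAdjoint_iff']
  refine ContinuousLinearMap.ext fun x => ext_inner_left ℂ fun y => ?_
  rw [adjoint_inner_right]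
  refine (lp.hasSum_inner (V y) x).unique ((lp.hasSum_inner y (V x)).congr_fun fun β => ?_)
  rw [hV, hV, inner_smul_left, inner_smul_right, Complex.conj_ofReal]

end IsDiagonal

end Diagonal

section UniversalModel

variable {k : ℕ} {n : Fin k → ℕ} {E : Type u} [NormedAddCommGroup E] [InnerProductSpace ℂ E]
  [CompleteSpace E] (f : ∀ i, PosRegular (n i)) (m : Fin k → ℕ)

theorem adjoint_universalModel_apply (i : Fin k) (j : Fin (n i)) (x : FockTensor n E)
    (γ : ∀ i, List (Fin (n i))) :
    adjoint (universalModel f m E i j) x γ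
      = (weight (f i) (m i) j (γ i) : ℂ) • x (Function.update γ i (j :: γ i)) := by
  rw [universalModel, adjoint_adjoint]
  rfl

theorem universalModel_commute {i i' : Fin k} (hi : i ≠ i') (j : Fin (n i)) (j' : Fin (n i')) :
    Commute (universalModel f m E i j) (universalModel f m E i' j') := by
  refine commute_star_star.1 (ContinuousLinearMap.ext fun x => lp.ext (funext fun γ => ?_))
  simp only [star_eq_adjoint, mul_apply_eq_comp, adjoint_universalModel_apply,
    Function.update_of_ne hi, Function.update_of_ne hi.symm]
  rw [smul_comm]
  exact congrArg _ (congrArg _ (congrArg x (Function.update_comm hi _ _ γ)))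

theorem adjoint_wordOp_universalModel_apply (i : Fin k) (α : List (Fin (n i)))
    (x : FockTensor n E) (γ : ∀ i, List (Fin (n i))) :
    adjoint (wordOp (universalModel f m E i) α) x γ
      = ((√(bCoeff (f i) (m i) (γ i)) / √(bCoeff (f i) (m i) (α ++ γ i)) : ℝ) : ℂ)
        • x (Function.update γ i (α ++ γ i)) := by
  induction α generalizing x with
  | nil =>
    rw [adjoint_wordOp_nil, one_apply_eq_self, List.nil_append, Function.update_eq_self,
      div_self (Real.sqrt_pos.2 (bCoeff_pos _ _ _)).ne', Complex.ofReal_one, one_smul]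
  | cons j α ih =>
    rw [adjoint_wordOp_cons_apply, ih, adjoint_universalModel_apply, smul_smul,
      ← Complex.ofReal_mul, Function.update_self, Function.update_idem, weight, List.cons_append,
      div_mul_div_cancel₀ (Real.sqrt_pos.2 (bCoeff_pos _ _ _)).ne']

theorem adjoint_wordOp_universalModel_single (i : Fin k) (α : List (Fin (n i)))
    (β : ∀ i, List (Fin (n i))) (y : E) :
    adjoint (wordOp (universalModel f m E i) α) (lp.single 2 β y)
      = if α <+: β i then ((√(bCoeff (f i) (m i) ((β i).drop α.length))
          / √(bCoeff (f i) (m i) (β i)) : ℝ) : ℂ)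
        • lp.single 2 (Function.update β i ((β i).drop α.length)) y else 0 := by
  ext γ : 2
  rw [adjoint_wordOp_universalModel_apply, lp.coeFn_single]
  by_cases hγ : Function.update γ i (α ++ γ i) = β
  · subst hγ
    simp
  · rw [Pi.single_eq_of_ne hγ, smul_zero]
    split_ifs with hα
    · have hne : γ ≠ Function.update β i ((β i).drop α.length) := by
        rintro rfl
        simp [List.prefix_iff_eq_append.1 hα] at hγ
      rw [lp.coeFn_smul, Pi.smul_apply, lp.coeFn_single, Pi.single_eq_of_ne hne, smul_zero]
    · rfl

theorem wordOp_universalModel_apply (i : Fin k) (α : List (Fin (n i))) (x : FockTensor n E)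
    (β : ∀ i, List (Fin (n i))) :
    wordOp (universalModel f m E i) α x β
      = if α <+: β i then ((√(bCoeff (f i) (m i) ((β i).drop α.length))
          / √(bCoeff (f i) (m i) (β i)) : ℝ) : ℂ)
        • x (Function.update β i ((β i).drop α.length)) else 0 := by
  refine ext_inner_left ℂ fun y : E => (inner_apply_eq_inner_single β y _).trans ?_
  rw [← adjoint_inner_left, adjoint_wordOp_universalModel_single]
  split_ifs
  · rw [inner_smul_left, lp.inner_single_left, inner_smul_right, Complex.conj_ofReal]
  · rw [inner_zero_left, inner_zero_right]

variable {f m}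

theorem IsDiagonal.wordOp_conj {V : FockTensor n E →L[ℂ] FockTensor n E}
    {d : (∀ i, List (Fin (n i))) → ℝ} (hV : IsDiagonal V d) {i : Fin k} (hm : 1 ≤ m i)
    (α : List (Fin (n i))) :
    IsDiagonal (wordOp (universalModel f m E i) α ∘L V ∘L
        adjoint (wordOp (universalModel f m E i) α)) fun β =>
      if α <+: β i then invCoeff (f i) (m i) ((β i).drop α.length) / invCoeff (f i) (m i) (β i) *
        d (Function.update β i ((β i).drop α.length)) else 0 := by
  intro x β
  beta_reduce
  rw [comp_apply, comp_apply, wordOp_universalModel_apply]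
  split_ifs with hα
  · rw [hV, adjoint_wordOp_universalModel_apply, Function.update_self, Function.update_idem,
      List.prefix_iff_eq_append.1 hα, Function.update_eq_self, smul_smul, smul_smul,
      ← Complex.ofReal_mul, ← Complex.ofReal_mul, ← bCoeff_eq_invCoeff _ hm,
      ← bCoeff_eq_invCoeff _ hm, mul_right_comm, div_mul_div_comm,
      Real.mul_self_sqrt (bCoeff_pos _ _ _).le, Real.mul_self_sqrt (bCoeff_pos _ _ _).le]
  · rw [Complex.ofReal_zero, zero_smul]

theorem sum_splits_div_le {n : ℕ} (f : PosRegular n) {m : ℕ} (hm : 1 ≤ m) (β : List (Fin n)) :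
    ∑ p ∈ splits β, f.coeff p.1 * (invCoeff f m p.2 / invCoeff f m β) ≤ 1 := by
  obtain ⟨m, rfl⟩ := Nat.exists_eq_add_of_le' hm
  simp_rw [← mul_div_assoc]
  rw [← Finset.sum_div, div_le_one (invCoeff_pos f hm β), invCoeff_succ_left f m β]
  exact le_add_of_nonneg_left (invCoeff_nonneg f m β)

theorem universalModel_isRowContraction {i : Fin k} (hm : 1 ≤ m i) :
    IsRowContraction (f i) (universalModel f m E i) := by
  intro x F
  have hnorm : ∀ α, HasSum (fun β : ∀ i, List (Fin (n i)) => (if α <+: β i then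
      invCoeff (f i) (m i) ((β i).drop α.length) / invCoeff (f i) (m i) (β i) else 0) *
        ‖x β‖ ^ 2) (‖adjoint (wordOp (universalModel f m E i) α) x‖ ^ 2) := fun α => by
    have hconj : ‖adjoint (wordOp (universalModel f m E i) α) x‖ ^ 2
        = (wordOp (universalModel f m E i) α ∘L 1 ∘L
          adjoint (wordOp (universalModel f m E i) α)).reApplyInnerSelf x := by
      rw [reApplyInnerSelf_conj, reApplyInnerSelf_one]
    rw [hconj]
    simpa only [mul_one] using (IsDiagonal.one.wordOp_conj hm α).hasSum_reApplyInnerSelf x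
  refine hasSum_le (fun β => ?_) (hasSum_sum fun α (_ : α ∈ F) =>
    (hnorm α).mul_left ((f i).coeff α)) (lp_two_hasSum_norm_sq x)
  simp only [← mul_assoc, ← Finset.sum_mul, mul_ite, mul_zero]
  refine mul_le_of_le_one_left (sq_nonneg _) (le_trans ?_ (sum_splits_div_le (f i) hm (β i)))
  refine sum_le_hasSum F (fun α _ => ?_) (hasSum_prefix (β i) fun α γ =>
    (f i).coeff α * (invCoeff (f i) (m i) γ / invCoeff (f i) (m i) (β i)))
  split_ifs
  · exact mul_nonneg ((f i).coeff_nonneg _)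
      (div_nonneg (invCoeff_nonneg _ _ _) (invCoeff_nonneg _ _ _))
  · exact le_rfl

namespace IsDiagonal

variable {V : FockTensor n E →L[ℂ] FockTensor n E} {d : (∀ i, List (Fin (n i))) → ℝ}

protected theorem phi (hV : IsDiagonal V d) {i : Fin k} (hm : 1 ≤ m i) :
    IsDiagonal (phi (f i) (universalModel f m E i) V) fun β => ∑ p ∈ splits (β i),
      (f i).coeff p.1 * (invCoeff (f i) (m i) p.2 / invCoeff (f i) (m i) (β i) *
        d (Function.update β i p.2)) := by
  intro x β
  refine ext_inner_left ℂ fun y : E => (inner_apply_eq_inner_single β y _).trans ?_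
  rw [inner_smul_right]
  have hprefix := Complex.hasSum_ofReal.2 (hasSum_prefix (β i) fun α γ => (f i).coeff α *
    (invCoeff (f i) (m i) γ / invCoeff (f i) (m i) (β i) * d (Function.update β i γ)))
  refine ((universalModel_isRowContraction hm).hasSum_inner_phi V x _).unique
    ((hprefix.mul_right _).congr_fun fun α => ?_)
  have hconj := hV.wordOp_conj (f := f) hm α x β
  rw [adjoint_inner_left, lp.inner_single_left]
  refine (congrArg (fun z => ((f i).coeff α : ℂ) * inner ℂ y z) hconj).trans ?_
  rw [inner_smul_right, ← mul_assoc, ← Complex.ofReal_mul, mul_ite, mul_zero]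

theorem iterate (hV : IsDiagonal V d) {i : Fin k} (hm : 1 ≤ m i)
    (hd : ∀ β δ, d (Function.update β i δ) = d β) {p : ℕ} (hp : p ≤ m i) :
    IsDiagonal ((fun V => V - phi (f i) (universalModel f m E i) V)^[p] V) fun β =>
      invCoeff (f i) (m i - p) (β i) / invCoeff (f i) (m i) (β i) * d β := by
  induction p with
  | zero =>
    intro x β
    simp only [Function.iterate_zero_apply, Nat.sub_zero, div_self (invCoeff_pos _ hm _).ne',
      one_mul]
    exact hV x β
  | succ p ih =>
    intro x β
    have ih := ih (by lia)
    rw [Function.iterate_succ_apply', sub_apply, lp.coeFn_sub, Pi.sub_apply, ih, ih.phi hm,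
      ← sub_smul, ← Complex.ofReal_sub]
    congr 2
    beta_reduce
    have hrec := invCoeff_succ_left (f i) (m i - (p + 1)) (β i)
    rw [show m i - (p + 1) + 1 = m i - p by lia] at hrec
    rw [hrec, add_div, add_mul, add_sub_assoc, Finset.sum_div, Finset.sum_mul, add_eq_left,
      sub_eq_zero]
    refine Finset.sum_congr rfl fun q _ => ?_
    have hpos := (invCoeff_pos (f i) hm q.2).ne'
    rw [Function.update_self, hd]
    field_simp

end IsDiagonal

theorem isDiagonal_defectFold_universalModel (hm : ∀ i, 1 ≤ m i) {p : Fin k → ℕ} (hp : p ≤ m)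
    {l : List (Fin k)} (hl : l.Nodup) :
    IsDiagonal (defectFold f (universalModel f m E) p l 1) fun β =>
      (l.map fun i => invCoeff (f i) (m i - p i) (β i) / invCoeff (f i) (m i) (β i)).prod := by
  induction l with
  | nil => exact IsDiagonal.one
  | cons i l ih =>
    rw [List.nodup_cons] at hl
    refine (ih hl.2).iterate (hm i) (fun β δ => ?_) (hp i)
    congr 1
    refine List.map_congr_left fun i' hi' => ?_
    rw [Function.update_of_ne (ne_of_mem_of_not_mem hi' hl.1)]

theorem defectMap_universalModel_one_nonneg (hm : ∀ i, 1 ≤ m i) {p : Fin k → ℕ} (hp : p ≤ m) :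
    0 ≤ defectMap f (universalModel f m E) p 1 := by
  refine (isDiagonal_defectFold_universalModel hm hp (List.nodup_finRange k)).nonneg
    fun β => List.prod_nonneg fun a ha => ?_
  obtain ⟨i, -, rfl⟩ := List.mem_map.1 ha
  exact div_nonneg (invCoeff_nonneg _ _ _) (invCoeff_nonneg _ _ _)

end UniversalModel

section Truncated

variable {k : ℕ} {n : Fin k → ℕ} {E : Type u} [NormedAddCommGroup E] [InnerProductSpace ℂ E]

/-- The vectors whose coordinates vanish at all tuples with a word of length greater than `N`. -/
def truncated (n : Fin k → ℕ) (E : Type u) [NormedAddCommGroup E] [InnerProductSpace ℂ E]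
    (N : ℕ) : Set (FockTensor n E) :=
  {x | ∀ β : (∀ i, List (Fin (n i))), (∃ i, N < (β i).length) → x β = 0}

theorem dense_iUnion_truncated : Dense (⋃ N, truncated n E N) := by
  intro x
  refine mem_closure_of_tendsto (lp.hasSum_single (by norm_num) x)
    (Eventually.of_forall fun F => ?_)
  obtain ⟨N, hN⟩ := exists_subset_box F
  refine Set.mem_iUnion.2 ⟨N, ?_⟩
  rintro β ⟨i, hi⟩
  rw [lp.coeFn_sum, Finset.sum_apply]
  refine Finset.sum_eq_zero fun γ hγ => ?_
  rw [lp.coeFn_single, Pi.single_eq_of_ne]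
  rintro rfl
  exact hi.not_ge ((mem_box.1 (hN hγ) i).1 (List.mem_finRange i))

variable [CompleteSpace E] {f : ∀ i, PosRegular (n i)} {m : Fin k → ℕ} {N : ℕ}
  {x : FockTensor n E}

theorem adjoint_wordOp_universalModel_mem_truncated (hx : x ∈ truncated n E N) (i : Fin k)
    (α : List (Fin (n i))) :
    adjoint (wordOp (universalModel f m E i) α) x ∈ truncated n E N := by
  rintro β ⟨l, hl⟩
  rw [adjoint_wordOp_universalModel_apply, hx, smul_zero]
  refine ⟨l, ?_⟩
  rcases eq_or_ne l i with rfl | h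
  · rw [Function.update_self, List.length_append]
    lia
  · rwa [Function.update_of_ne h]

theorem adjoint_wordOp_universalModel_eq_zero (hx : x ∈ truncated n E N) (i : Fin k)
    {α : List (Fin (n i))} (hα : N < α.length) :
    adjoint (wordOp (universalModel f m E i) α) x = 0 := by
  ext β : 2
  rw [adjoint_wordOp_universalModel_apply, hx, smul_zero]
  · rfl
  · exact ⟨i, by rw [Function.update_self, List.length_append]; lia⟩

end Truncated

/-! ### Intertwining operators -/

section Intertwining

variable {H G : Type u} [NormedAddCommGroup H] [InnerProductSpace ℂ H] [CompleteSpace H]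
  [NormedAddCommGroup G] [InnerProductSpace ℂ G] [CompleteSpace G] {S : H →L[ℂ] G}

section SingleTuple

variable {n : ℕ} {f : PosRegular n} {X : Fin n → H →L[ℂ] H} {X' : Fin n → G →L[ℂ] G}

theorem adjoint_wordOp_intertwine (h : ∀ j, S ∘L X j = X' j ∘L S) (α : List (Fin n)) (y : G) :
    adjoint S (adjoint (wordOp X' α) y) = adjoint (wordOp X α) (adjoint S y) := by
  induction α generalizing y with
  | nil => rw [adjoint_wordOp_nil, adjoint_wordOp_nil, one_apply_eq_self, one_apply_eq_self]
  | cons j α ih =>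
    rw [adjoint_wordOp_cons_apply, adjoint_wordOp_cons_apply, ih, ← comp_apply (adjoint S),
      ← adjoint_comp, ← h, adjoint_comp, comp_apply]

theorem phi_intertwine (h : ∀ j, S ∘L X j = X' j ∘L S) (hX : IsRowContraction f X)
    (hX' : IsRowContraction f X') (V : H →L[ℂ] H) :
    phi f X' (S ∘L V ∘L adjoint S) = S ∘L phi f X V ∘L adjoint S := by
  refine ContinuousLinearMap.ext fun x => ext_inner_left ℂ fun y => ?_
  refine (hX'.hasSum_inner_phi _ x y).unique ?_
  rw [comp_apply, comp_apply, ← adjoint_inner_left]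
  refine (hX.hasSum_inner_phi V (adjoint S x) (adjoint S y)).congr_fun fun α => ?_
  rw [comp_apply, comp_apply, ← adjoint_inner_left, adjoint_wordOp_intertwine h,
    adjoint_wordOp_intertwine h]

end SingleTuple

variable {k : ℕ} {n : Fin k → ℕ} {f : ∀ i, PosRegular (n i)} {X : ∀ i, Fin (n i) → H →L[ℂ] H}
  {X' : ∀ i, Fin (n i) → G →L[ℂ] G}

theorem defectFold_intertwine (h : ∀ i j, S ∘L X i j = X' i j ∘L S)
    (hX : ∀ i, IsRowContraction (f i) (X i)) (hX' : ∀ i, IsRowContraction (f i) (X' i))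
    (p : Fin k → ℕ) (l : List (Fin k)) (V : H →L[ℂ] H) :
    defectFold f X' p l (S ∘L V ∘L adjoint S) = S ∘L defectFold f X p l V ∘L adjoint S := by
  induction l with
  | nil => rfl
  | cons i l ih =>
    have hconj : Function.Semiconj (fun V : H →L[ℂ] H => S ∘L V ∘L adjoint S)
        (fun V => V - phi (f i) (X i) V) (fun V => V - phi (f i) (X' i) V) := fun V => by
      beta_reduce
      rw [phi_intertwine (h i) (hX i) (hX' i), sub_comp, comp_sub]
    rw [defectFold_cons, defectFold_cons, ih]
    exact ((hconj.iterate_right (p i)).eq _).symm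

theorem adjoint_adjointWordProd_intertwine (h : ∀ i j, S ∘L X i j = X' i j ∘L S)
    (l : List (Fin k)) (β : ∀ i, List (Fin (n i))) (y : G) :
    adjoint S (adjointWordProd X' l β y) = adjointWordProd X l β (adjoint S y) := by
  induction l with
  | nil => rfl
  | cons i l ih =>
    rw [adjointWordProd_cons, adjointWordProd_cons, mul_apply_eq_comp, mul_apply_eq_comp,
      adjoint_wordOp_intertwine (h i), ih]

theorem boxSum_intertwine (h : ∀ i j, S ∘L X i j = X' i j ∘L S) (m : Fin k → ℕ) (N : ℕ)
    (l : List (Fin k)) (g : H → ℝ) (y : G) :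
    boxSum f m X N l g (adjoint S y) = boxSum f m X' N l (g ∘ adjoint S) y := by
  refine Finset.sum_congr rfl fun β _ => ?_
  rw [Function.comp_apply, adjoint_adjointWordProd_intertwine h]

end Intertwining

section Kernel

variable {k : ℕ} {n : Fin k → ℕ} {H : Type u} [NormedAddCommGroup H] [InnerProductSpace ℂ H]

theorem commute_wordOp {n : ℕ} {X : Fin n → H →L[ℂ] H} {A : H →L[ℂ] H}
    (h : ∀ j, Commute A (X j)) (α : List (Fin n)) : Commute A (wordOp X α) :=
  Commute.list_prod_right _ _ fun B hB => by
    obtain ⟨j, -, rfl⟩ := List.mem_map.1 hB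
    exact h j

variable [CompleteSpace H]

theorem adjointWordProd_update_cons {T : ∀ i, Fin (n i) → H →L[ℂ] H}
    (hT : ∀ i i', i ≠ i' → ∀ j j', Commute (T i j) (T i' j')) {l : List (Fin k)}
    (hl : l.Nodup) {i : Fin k} (hi : i ∈ l) (j : Fin (n i)) (β : ∀ i, List (Fin (n i))) :
    adjointWordProd T l (Function.update β i (j :: β i))
      = adjointWordProd T l β * adjoint (T i j) := by
  induction l with
  | nil => exact absurd hi List.not_mem_nil
  | cons i' l ih =>
    rw [List.nodup_cons] at hl
    rw [adjointWordProd_cons, adjointWordProd_cons, mul_assoc]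
    rcases eq_or_ne i i' with rfl | hne
    · have hcomm : Commute (adjoint (T i j)) (adjointWordProd T l β) := by
        refine Commute.list_prod_right _ _ fun B hB => ?_
        obtain ⟨i', hi', rfl⟩ := List.mem_map.1 hB
        have hne := (ne_of_mem_of_not_mem hi' hl.1).symm
        exact (commute_wordOp (hT i i' hne j) (β i')).star_star
      have hcongr := adjointWordProd_congr T fun i' hi' =>
        Function.update_of_ne (ne_of_mem_of_not_mem hi' hl.1) (j :: β i) β
      have hword : adjoint (wordOp (T i) (j :: β i))
          = adjoint (wordOp (T i) (β i)) * adjoint (T i j) :=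
        ContinuousLinearMap.ext fun x => adjoint_wordOp_cons_apply _ _ _ x
      rw [Function.update_self, hcongr, hword, mul_assoc, hcomm.eq]
    · rw [Function.update_of_ne hne.symm]
      exact congrArg _ (ih hl.2 (List.mem_of_ne_of_mem hne hi))

theorem MemPolydomain.berezinKernel_intertwine {f : ∀ i, PosRegular (n i)} {m : Fin k → ℕ}
    {T : ∀ i, Fin (n i) → H →L[ℂ] H} (hT : MemPolydomain f m T) (hm : ∀ i, 1 ≤ m i)
    (i : Fin k) (j : Fin (n i)) :
    berezinKernel f m T ∘L adjoint (T i j)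
      = adjoint (universalModel f m (defectSpace f m T) i j) ∘L berezinKernel f m T := by
  ext h β : 3
  have hK := isBerezinKernel_iff.1 (hT.isBerezinKernel_berezinKernel hm)
  rw [comp_apply, comp_apply, adjoint_universalModel_apply, hK, hK, kernelEntry, kernelEntry,
    adjointWordProd_update_cons hT.commute (List.nodup_finRange k) (List.mem_finRange i),
    smul_apply, smul_apply, comp_apply, comp_apply, mul_apply_eq_comp, smul_smul,
    ← Complex.ofReal_mul]
  congr 2
  have hprod : ∏ i' ∈ {i}ᶜ, √(bCoeff (f i') (m i') (Function.update β i (j :: β i) i'))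
      = ∏ i' ∈ {i}ᶜ, √(bCoeff (f i') (m i') (β i')) :=
    Finset.prod_congr rfl fun i' hi' => by
      rw [Function.update_of_ne (by simpa using hi')]
  rw [Fintype.prod_eq_mul_prod_compl i, Fintype.prod_eq_mul_prod_compl i, hprod,
    Function.update_self, weight, ← mul_assoc,
    div_mul_cancel₀ _ (Real.sqrt_pos.2 (bCoeff_pos _ _ _)).ne']

end Kernel

/-! ### Model tuples -/

section ClosedRange

variable {H : Type u} [NormedAddCommGroup H] [InnerProductSpace ℂ H] [CompleteSpace H]

theorem denseRange_sqrtInto {A : H →L[ℂ] H} (hA : 0 ≤ A) : DenseRange (sqrtInto A) := by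
  intro z
  rw [closure_subtype]
  refine closure_mono ?_ z.2
  rintro _ ⟨x, rfl⟩
  exact ⟨sqrtInto A (opSqrt A x), ⟨opSqrt A x, rfl⟩, opSqrt_opSqrt_apply hA x⟩

theorem adjoint_sqrtInto (A : H →L[ℂ] H) :
    adjoint (sqrtInto A) = opSqrt A ∘L (closedRange A).subtypeL := by
  refine ContinuousLinearMap.ext fun z => ext_inner_left ℂ fun x => ?_
  rw [adjoint_inner_right, comp_apply, ← adjoint_inner_left, adjoint_opSqrt]
  rfl

theorem adjoint_sqrtInto_comp_sqrtInto {A : H →L[ℂ] H} (hA : 0 ≤ A) :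
    adjoint (sqrtInto A) ∘L sqrtInto A = A := by
  rw [adjoint_sqrtInto]
  exact ContinuousLinearMap.ext fun x => opSqrt_opSqrt_apply hA x

end ClosedRange

section DefectPositive

variable {k : ℕ} {n : Fin k → ℕ}

theorem defectMap_single {H : Type u} [NormedAddCommGroup H] [InnerProductSpace ℂ H]
    [CompleteSpace H] (f : ∀ i, PosRegular (n i)) (X : ∀ i, Fin (n i) → H →L[ℂ] H)
    (i : Fin k) (Y : H →L[ℂ] H) :
    defectMap f X (Pi.single i 1) Y = Y - phi (f i) (X i) Y := by
  obtain ⟨s, t, hst⟩ := List.append_of_mem (List.mem_finRange i)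
  have hnodup : (s ++ i :: t).Nodup := hst ▸ List.nodup_finRange k
  have hs : i ∉ s := fun h => List.disjoint_of_nodup_append hnodup h List.mem_cons_self
  have ht : i ∉ t := (List.nodup_cons.1 (List.nodup_append.1 hnodup).2.1).1
  have hfold : ∀ l : List (Fin k), i ∉ l → ∀ Z, defectFold f X (Pi.single i 1) l Z = Z :=
    fun l hl Z => (defectFold_congr f X (fun i' hi' =>
      Pi.single_eq_of_ne (ne_of_mem_of_not_mem hi' hl) _) Z).trans (defectFold_zero f X l Z)
  change defectFold f X _ (List.finRange k) Y = _
  rw [hst, defectFold_append, defectFold_cons, hfold t ht, hfold s hs, Pi.single_eq_same]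
  rfl

variable {D M : Type u} [NormedAddCommGroup D] [InnerProductSpace ℂ D] [CompleteSpace D]
  [NormedAddCommGroup M] [InnerProductSpace ℂ M] [CompleteSpace M]
  {f : ∀ i, PosRegular (n i)} {m : Fin k → ℕ}

/-- The positivity of `Δ_{f,W ⊗ I}^p(Y)` for all `p ≤ m`. -/
def IsDefectPositive (f : ∀ i, PosRegular (n i)) (m : Fin k → ℕ)
    (Y : FockTensor n D →L[ℂ] FockTensor n D) : Prop :=
  ∀ p : Fin k → ℕ, p ≤ m → 0 ≤ defectMap f (universalModel f m D) p Y

theorem IsMultiAnalytic.isDefectPositive (hm : ∀ i, 1 ≤ m i)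
    {Ψ : FockTensor n M →L[ℂ] FockTensor n D} (hΨ : IsMultiAnalytic f m Ψ) :
    IsDefectPositive f m (Ψ ∘L adjoint Ψ) := by
  intro p hp
  have hdefect : defectMap f (universalModel f m D) p (Ψ ∘L adjoint Ψ)
      = Ψ ∘L defectMap f (universalModel f m M) p 1 ∘L adjoint Ψ :=
    defectFold_intertwine hΨ (fun i => universalModel_isRowContraction (hm i))
      (fun i => universalModel_isRowContraction (hm i)) p (List.finRange k) 1
  have hpos : (defectMap f (universalModel f m M) p 1).IsPositive :=
    (nonneg_iff_isPositive _).1 (defectMap_universalModel_one_nonneg hm hp)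
  rw [hdefect]
  exact (nonneg_iff_isPositive _).2 (hpos.conj_adjoint Ψ)

namespace IsDefectPositive

theorem nonneg {Y : FockTensor n D →L[ℂ] FockTensor n D} (h : IsDefectPositive f m Y) :
    0 ≤ Y :=
  (h 0 fun _ => Nat.zero_le _).trans_eq (defectFold_zero f (universalModel f m D) _ Y)

theorem phi_le {Y : FockTensor n D →L[ℂ] FockTensor n D} (h : IsDefectPositive f m Y)
    {i : Fin k} (hm : 1 ≤ m i) : phi (f i) (universalModel f m D i) Y ≤ Y := by
  have hsingle : Pi.single i 1 ≤ m := update_le_iff.2 ⟨hm, fun _ _ => Nat.zero_le _⟩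
  rw [← sub_nonneg, ← defectMap_single]
  exact h _ hsingle

variable {R : FockTensor n D →L[ℂ] M}

theorem sum_norm_sq_apply_adjoint_wordOp_le (h : IsDefectPositive f m (adjoint R ∘L R))
    {i : Fin k} (hm : 1 ≤ m i) (F : Finset (List (Fin (n i)))) (x : FockTensor n D) :
    ∑ α ∈ F, (f i).coeff α * ‖R (adjoint (wordOp (universalModel f m D i) α) x)‖ ^ 2
      ≤ ‖R x‖ ^ 2 := by
  have hnorm : ∀ y, ‖R y‖ ^ 2 = (adjoint R ∘L R).reApplyInnerSelf y :=
    apply_norm_sq_eq_inner_adjoint_left R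
  simp only [hnorm]
  exact (sum_le_hasSum F
    (fun α _ => mul_nonneg ((f i).coeff_nonneg α) (reApplyInnerSelf_nonneg h.nonneg _))
    ((universalModel_isRowContraction hm).hasSum_reApplyInnerSelf_phi _ x)).trans
    (reApplyInnerSelf_mono (h.phi_le hm) x)

theorem norm_apply_adjoint_universalModel_le (h : IsDefectPositive f m (adjoint R ∘L R))
    {i : Fin k} (hm : 1 ≤ m i) (j : Fin (n i)) (x : FockTensor n D) :
    ‖R (adjoint (universalModel f m D i j) x)‖ ≤ √((f i).coeff [j])⁻¹ * ‖R x‖ := by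
  have hle := h.sum_norm_sq_apply_adjoint_wordOp_le hm {[j]} x
  rw [Finset.sum_singleton, adjoint_wordOp_cons_apply, adjoint_wordOp_nil, one_apply_eq_self,
    mul_comm, ← le_div_iff₀ ((f i).coeff_letter_pos j), div_eq_inv_mul] at hle
  rw [← Real.sqrt_sq (norm_nonneg (R x)),
    ← Real.sqrt_mul (inv_nonneg.2 ((f i).coeff_nonneg [j]))]
  exact Real.le_sqrt_of_sq_le hle

theorem exists_apply_eq_apply_adjoint_universalModel
    (h : IsDefectPositive f m (adjoint R ∘L R)) (hR : DenseRange R) {i : Fin k} (hm : 1 ≤ m i)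
    (j : Fin (n i)) :
    ∃ A : M →L[ℂ] M, ∀ x, A (R x) = R (adjoint (universalModel f m D i j) x) :=
  ⟨LinearMap.extendOfNorm (R ∘L adjoint (universalModel f m D i j)).toLinearMap R.toLinearMap,
    LinearMap.extendOfNorm_eq (e := R.toLinearMap) hR
      ⟨_, h.norm_apply_adjoint_universalModel_le hm j⟩⟩

end IsDefectPositive

/-- `X` is the tuple on `M` which a factorization `Y = R^* R`, with `R` of dense range, transports
from the universal model by `X_{i,j}^* R = R (W_{i,j}^* ⊗ I)`. The positivity of the defects of `Y`
is what makes the operators `X_{i,j}^*` bounded. For `R = Y^{1/2}`, as a map into the closure of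
the range of `Y`, this is the tuple `M_T` of the characteristic function. -/
structure IsModelTuple (f : ∀ i, PosRegular (n i)) (m : Fin k → ℕ) (R : FockTensor n D →L[ℂ] M)
    (X : ∀ i, Fin (n i) → M →L[ℂ] M) : Prop where
  isDefectPositive : IsDefectPositive f m (adjoint R ∘L R)
  denseRange : DenseRange R
  adjoint_apply : ∀ i j x, adjoint (X i j) (R x) = R (adjoint (universalModel f m D i j) x)

namespace IsModelTuple

variable {R : FockTensor n D →L[ℂ] M} {X : ∀ i, Fin (n i) → M →L[ℂ] M}

theorem eq_adjoint (h : IsModelTuple f m R X) {i : Fin k} {j : Fin (n i)} {A : M →L[ℂ] M}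
    (hA : ∀ x, A (R x) = R (adjoint (universalModel f m D i j) x)) : A = adjoint (X i j) :=
  DFunLike.coe_injective (h.denseRange.equalizer A.continuous (adjoint (X i j)).continuous
    (funext fun x => (hA x).trans (h.adjoint_apply i j x).symm))

theorem adjoint_intertwine (h : IsModelTuple f m R X) (i : Fin k) (j : Fin (n i)) :
    adjoint R ∘L X i j = universalModel f m D i j ∘L adjoint R := by
  have hR : adjoint (X i j) ∘L R = R ∘L adjoint (universalModel f m D i j) :=
    ContinuousLinearMap.ext (h.adjoint_apply i j)
  simpa only [adjoint_comp, adjoint_adjoint] using congrArg adjoint hR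

theorem isRowContraction (h : IsModelTuple f m R X) (hm : ∀ i, 1 ≤ m i) (i : Fin k) :
    IsRowContraction (f i) (X i) := by
  intro z F
  refine h.denseRange.induction_on
    (p := fun z => ∑ α ∈ F, (f i).coeff α * ‖adjoint (wordOp (X i) α) z‖ ^ 2 ≤ ‖z‖ ^ 2) z
    (isClosed_le (by fun_prop) (by fun_prop)) fun x => ?_
  have hword := fun α => adjoint_wordOp_intertwine (h.adjoint_intertwine i) α x
  simp only [adjoint_adjoint] at hword
  simp only [← hword]
  exact h.isDefectPositive.sum_norm_sq_apply_adjoint_wordOp_le (hm i) F x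

theorem defectMap_conj (h : IsModelTuple f m R X) (hm : ∀ i, 1 ≤ m i) (p : Fin k → ℕ) :
    defectMap f (universalModel f m D) p (adjoint R ∘L R)
      = adjoint R ∘L defectMap f X p 1 ∘L adjoint (adjoint R) := by
  have hfold := defectFold_intertwine h.adjoint_intertwine (h.isRowContraction hm)
    (fun i => universalModel_isRowContraction (hm i)) p (List.finRange k) 1
  rwa [adjoint_adjoint] at hfold ⊢

theorem reApplyInnerSelf_defectMap (h : IsModelTuple f m R X) (hm : ∀ i, 1 ≤ m i)
    (p : Fin k → ℕ) (x : FockTensor n D) :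
    (defectMap f X p 1).reApplyInnerSelf (R x)
      = (defectMap f (universalModel f m D) p (adjoint R ∘L R)).reApplyInnerSelf x := by
  rw [h.defectMap_conj hm, reApplyInnerSelf_conj, adjoint_adjoint]

theorem commute (h : IsModelTuple f m R X) {i i' : Fin k} (hi : i ≠ i') (j : Fin (n i))
    (j' : Fin (n i')) : Commute (X i j) (X i' j') := by
  refine commute_star_star.1 (DFunLike.coe_injective (h.denseRange.equalizer
    (ContinuousLinearMap.continuous _) (ContinuousLinearMap.continuous _) (funext fun x => ?_)))
  have hW : Commute (adjoint (universalModel f m D i j)) (adjoint (universalModel f m D i' j')) :=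
    (universalModel_commute f m hi j j').star_star
  simp only [Function.comp_apply, star_eq_adjoint, mul_apply_eq_comp, h.adjoint_apply]
  exact congrArg (fun A : FockTensor n D →L[ℂ] FockTensor n D => R (A x)) hW.eq

theorem defectMap_one_nonneg (h : IsModelTuple f m R X) (hm : ∀ i, 1 ≤ m i) {p : Fin k → ℕ}
    (hp : p ≤ m) : 0 ≤ defectMap f X p 1 := by
  refine (nonneg_iff_reApplyInnerSelf _).2
    ⟨defectFold_isSelfAdjoint (h.isRowContraction hm) _ _ (IsSelfAdjoint.one _), fun z => ?_⟩
  refine h.denseRange.induction_on (p := fun z => 0 ≤ (defectMap f X p 1).reApplyInnerSelf z) z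
    (isClosed_le continuous_const (reApplyInnerSelf_continuous _)) fun x => ?_
  rw [h.reApplyInnerSelf_defectMap hm]
  exact reApplyInnerSelf_nonneg (h.isDefectPositive p hp) x

theorem memPolydomain (h : IsModelTuple f m R X) (hm : ∀ i, 1 ≤ m i) : MemPolydomain f m X where
  commute _ _ hi := h.commute hi
  summable i := ((h.isRowContraction hm i).hasSum_phiTerm 1).summable
  phi_le_one i := (h.isRowContraction hm i).phi_one_le
  defect_nonneg ε := h.defectMap_one_nonneg hm fun i =>
    mul_le_of_le_one_left (Nat.zero_le _) (Nat.lt_succ_iff.1 (ε i).2)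

theorem boxSum_defectMap_eq_of_mem_truncated (h : IsModelTuple f m R X) (hm : ∀ i, 1 ≤ m i)
    {N : ℕ} {x : FockTensor n D} (hx : x ∈ truncated n D N) :
    boxSum f m X N (List.finRange k) (defectMap f X m 1).reApplyInnerSelf (R x) = ‖R x‖ ^ 2 := by
  have hboxSum := boxSum_intertwine (f := f) h.adjoint_intertwine m N (List.finRange k)
    (defectMap f X m 1).reApplyInnerSelf x
  rw [adjoint_adjoint] at hboxSum
  have hform := funext (h.reApplyInnerSelf_defectMap hm m)
  calc
    _ = boxSum f m (universalModel f m D) N (List.finRange k)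
        (defectMap f (universalModel f m D) m (adjoint R ∘L R)).reApplyInnerSelf x :=
      hboxSum.trans (congrArg (boxSum f m (universalModel f m D) N (List.finRange k) · x) hform)
    _ = (adjoint R ∘L R).reApplyInnerSelf x :=
      boxSum_defectFold_eq (fun i => universalModel_isRowContraction (hm i)) m
        (fun y hy => adjoint_wordOp_universalModel_mem_truncated hy)
        (fun y hy i _ => adjoint_wordOp_universalModel_eq_zero hy i) (List.nodup_finRange k) _ hx
    _ = ‖R x‖ ^ 2 := (apply_norm_sq_eq_inner_adjoint_left R x).symm

theorem norm_apply_le_of_mem_truncated (h : IsModelTuple f m R X) (hm : ∀ i, 1 ≤ m i) {N : ℕ}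
    {x : FockTensor n D} (hx : x ∈ truncated n D N) : ‖R x‖ ≤ ‖berezinKernel f m X (R x)‖ := by
  have hX := h.memPolydomain hm
  refine (sq_le_sq₀ (norm_nonneg _) (norm_nonneg _)).1 ?_
  rw [← h.boxSum_defectMap_eq_of_mem_truncated hm hx,
    ← sum_box_norm_kernelEntry_sq hm hX.defectMap_nonneg]
  simp only [← isBerezinKernel_iff.1 (hX.isBerezinKernel_berezinKernel hm)]
  exact sum_le_hasSum _ (fun β _ => sq_nonneg _) (lp_two_hasSum_norm_sq _)

theorem norm_berezinKernel (h : IsModelTuple f m R X) (hm : ∀ i, 1 ≤ m i) (z : M) :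
    ‖berezinKernel f m X z‖ = ‖z‖ := by
  refine le_antisymm ((h.memPolydomain hm).norm_berezinKernel_le hm z) ?_
  refine h.denseRange.induction_on (p := fun z => ‖z‖ ≤ ‖berezinKernel f m X z‖) z
    (isClosed_le (by fun_prop) (by fun_prop)) fun x => ?_
  refine isClosed_property (p := fun x => ‖R x‖ ≤ ‖berezinKernel f m X (R x)‖)
    dense_iUnion_truncated.denseRange_val (isClosed_le (by fun_prop) (by fun_prop)) ?_ x
  rintro ⟨x, hx⟩
  obtain ⟨N, hN⟩ := Set.mem_iUnion.1 hx
  exact h.norm_apply_le_of_mem_truncated hm hN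

theorem isMultiAnalytic (h : IsModelTuple f m R X) (hm : ∀ i, 1 ≤ m i) :
    IsMultiAnalytic f m (adjoint R ∘L adjoint (berezinKernel f m X)) := by
  intro i j
  have hK := congrArg adjoint ((h.memPolydomain hm).berezinKernel_intertwine hm i j)
  rw [adjoint_comp, adjoint_comp, adjoint_adjoint, adjoint_adjoint] at hK
  rw [comp_assoc, ← hK, ← comp_assoc, h.adjoint_intertwine, comp_assoc]

theorem comp_adjoint_berezinKernel_comp_adjoint (h : IsModelTuple f m R X)
    (hm : ∀ i, 1 ≤ m i) :
    (adjoint R ∘L adjoint (berezinKernel f m X)) ∘L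
      adjoint (adjoint R ∘L adjoint (berezinKernel f m X)) = adjoint R ∘L R := by
  have hisom := (norm_map_iff_adjoint_comp_self (berezinKernel f m X)).1 (h.norm_berezinKernel hm)
  rw [adjoint_comp, adjoint_adjoint, adjoint_adjoint, comp_assoc,
    ← comp_assoc _ (berezinKernel _ _ _), hisom]
  rfl

end IsModelTuple

end DefectPositive

/-! ### The characteristic function -/

section CharacteristicFunction

variable {k : ℕ} {n : Fin k → ℕ} {H : Type u} [NormedAddCommGroup H] [InnerProductSpace ℂ H]
  [CompleteSpace H] {f : ∀ i, PosRegular (n i)} {m : Fin k → ℕ} {T : ∀ i, Fin (n i) → H →L[ℂ] H}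

theorem HasCharacteristicFunction.isDefectPositive (hm : ∀ i, 1 ≤ m i)
    (h : HasCharacteristicFunction f m T) : IsDefectPositive f m (kernelDefect f m T) := by
  obtain ⟨E, _, _, _, Ψ, hΨ, hK⟩ := h
  rw [kernelDefect, sub_eq_iff_eq_add'.2 hK.symm]
  exact hΨ.isDefectPositive hm

theorem theta_eq (f : ∀ i, PosRegular (n i)) (m : Fin k → ℕ) (T : ∀ i, Fin (n i) → H →L[ℂ] H) :
    theta f m T = adjoint (sqrtInto (kernelDefect f m T)) ∘L
      adjoint (berezinKernel f m (modelTuple f m T)) :=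
  congrArg (fun S => S ∘L adjoint (berezinKernel f m (modelTuple f m T)))
    (adjoint_sqrtInto (kernelDefect f m T)).symm

namespace IsDefectPositive

theorem isModelTuple (h : IsDefectPositive f m (kernelDefect f m T)) (hm : ∀ i, 1 ≤ m i) :
    IsModelTuple f m (sqrtInto (kernelDefect f m T)) (modelTuple f m T) := by
  have hY : IsDefectPositive f m
      (adjoint (sqrtInto (kernelDefect f m T)) ∘L sqrtInto (kernelDefect f m T)) := by
    rwa [adjoint_sqrtInto_comp_sqrtInto h.nonneg]
  refine ⟨hY, denseRange_sqrtInto h.nonneg, fun i j => ?_⟩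
  have hex : ∃ A, IsModelAdjoint f m T i j A :=
    hY.exists_apply_eq_apply_adjoint_universalModel (denseRange_sqrtInto h.nonneg) (hm i) j
  rw [modelTuple, dif_pos hex, adjoint_adjoint]
  exact hex.choose_spec

theorem theta_isMultiAnalytic (h : IsDefectPositive f m (kernelDefect f m T))
    (hm : ∀ i, 1 ≤ m i) : IsMultiAnalytic f m (theta f m T) := by
  rw [theta_eq]
  exact (h.isModelTuple hm).isMultiAnalytic hm

theorem theta_comp_adjoint (h : IsDefectPositive f m (kernelDefect f m T))
    (hm : ∀ i, 1 ≤ m i) : theta f m T ∘L adjoint (theta f m T) = kernelDefect f m T :=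
  (congrArg (fun S => S ∘L adjoint S) (theta_eq f m T)).trans <|
    ((h.isModelTuple hm).comp_adjoint_berezinKernel_comp_adjoint hm).trans
      (adjoint_sqrtInto_comp_sqrtInto h.nonneg)

theorem berezinKernel_comp_adjoint_add_theta (h : IsDefectPositive f m (kernelDefect f m T))
    (hm : ∀ i, 1 ≤ m i) :
    berezinKernel f m T ∘L adjoint (berezinKernel f m T)
      + theta f m T ∘L adjoint (theta f m T) = 1 := by
  rw [h.theta_comp_adjoint hm, kernelDefect, add_sub_cancel]

theorem hasCharacteristicFunction (h : IsDefectPositive f m (kernelDefect f m T))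
    (hm : ∀ i, 1 ≤ m i) : HasCharacteristicFunction f m T :=
  ⟨_, _, _, inferInstance, theta f m T, h.theta_isMultiAnalytic hm,
    h.berezinKernel_comp_adjoint_add_theta hm⟩

end IsDefectPositive

end CharacteristicFunction

end NCPolydomain

theorem mainTheorem8 {k : ℕ} (hk : 1 ≤ k) (n m : Fin k → ℕ)
    (hn : ∀ i, 1 ≤ n i) (hm : ∀ i, 1 ≤ m i)
    (f : ∀ i, PosRegular (n i))
    {H : Type*} [NormedAddCommGroup H] [InnerProductSpace ℂ H] [CompleteSpace H]
    (T : ∀ i, Fin (n i) → H →L[ℂ] H) (hT : MemPolydomain f m T) :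
    IsBerezinKernel f m T (berezinKernel f m T) ∧
    (HasCharacteristicFunction f m T ↔
      ∀ p : Fin k → ℕ, p ≤ m →
        0 ≤ defectMap f (universalModel f m (defectSpace f m T)) p
          (1 - berezinKernel f m T ∘L ContinuousLinearMap.adjoint (berezinKernel f m T))) ∧
    (HasCharacteristicFunction f m T →
      (∀ i j, IsModelAdjoint f m T i j (ContinuousLinearMap.adjoint (modelTuple f m T i j)) ∧
        ∀ A, IsModelAdjoint f m T i j A →
          A = ContinuousLinearMap.adjoint (modelTuple f m T i j)) ∧
      MemPolydomain f m (modelTuple f m T) ∧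
      IsBerezinKernel f m (modelTuple f m T) (berezinKernel f m (modelTuple f m T)) ∧
      IsMultiAnalytic f m (theta f m T) ∧
      berezinKernel f m T ∘L ContinuousLinearMap.adjoint (berezinKernel f m T)
        + theta f m T ∘L ContinuousLinearMap.adjoint (theta f m T) = 1) := by
  refine ⟨hT.isBerezinKernel_berezinKernel hm, ⟨fun h => h.isDefectPositive hm,
    fun h => IsDefectPositive.hasCharacteristicFunction h hm⟩, fun h => ?_⟩
  have hY := h.isDefectPositive hm
  have hmodel := hY.isModelTuple hm
  have hM := hmodel.memPolydomain hm
  exact ⟨fun i j => ⟨hmodel.adjoint_apply i j, fun A hA => hmodel.eq_adjoint hA⟩, hM,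
    hM.isBerezinKernel_berezinKernel hm, hY.theta_isMultiAnalytic hm,
    hY.berezinKernel_comp_adjoint_add_theta hm⟩
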